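/- Let $G$ and $K$ be compact Lie groups with Lie algebras $\mathfrak g$ and $\mathfrak k$, let $M$ and $N$ be connected Riemannian manifolds, and let $G$ and $K$ act smoothly, isometrically and with cohomogeneity one on $M$ and $N$, respectively. For $X$ in the Lie algebra of an acting group, let $X^{\ast}_{|p}=\frac{d}{ds}\big|_{s=0}\exp(sX)\cdot p$ denote its action field. Let $\gamma:\mathbb R\to M$ and $\hat\gamma:\mathbb R\to N$ be unit-speed normal geodesics, i.e. unit-speed geodesics that pass through all orbits perpendicularly. Let $A:G\to K$ be a Lie group homomorphism with differential $dA_e:\mathfrak g\to\mathfrak k$ at the identity, let $J\subset\mathbb R$ be open, let $r:J\to\mathbb R$ be smooth, and let $\psi:M\to N$ be a map with $$\psi(g\cdot\gamma(s))=A(g)\cdot\hat\gamma(r(s))\qquad\text{for all } g\in G,\ s\in J .$$ Let $t\in J$ be such that $\gamma(t)$ and $\hat\gamma(r(t))$ do not lie on singular orbits, i.e. their orbits have codimension one. Fix biinvariant metrics $Q$ on $G$ and $\hat Q$ on $K$. Let $\mathfrak n\subset\mathfrak g$ be the $Q$-orthogonal complement of the Lie algebra of the isotropy group of $\gamma(t)$,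 and $\hat{\mathfrak n}\subset\mathfrak k$ the $\hat Q$-orthogonal complement of the Lie algebra of the isotropy group of $\hat\gamma(r(t))$ (these are the Lie algebras of the principal isotropy groups along $\gamma$ and $\hat\gamma$). Let the metric endomorphism $\hat P_{r(t)}:\hat{\mathfrak n}\to\hat{\mathfrak n}$ be defined by $$\hat Q(X,\hat P_{r(t)}Y)=\langle X^{\ast},Y^{\ast}\rangle_{|\hat\gamma(r(t))}\qquad\text{for all } X,Y\in\hat{\mathfrak n};$$ for $Y\in\mathfrak k$, let $\hat P_{r(t)}Y$ mean $\hat P_{r(t)}$ applied to the $\hat Q$-orthogonal projection of $Y$ to $\hat{\mathfrak n}$. Let $E_1,\dots,E_n\in\mathfrak n$ be such that $E^{\ast}_{1|\gamma(t)},\dots,E^{\ast}_{n|\gamma(t)}$ form an orthonormal basis of $T_{\gamma(t)}(G\cdot\gamma(t))$. Then $\hat P_{r(t)}$ is invertible, $\sum_{\mu=1}^n[dA_eE_\mu,\hat P_{r(t)}dA_eE_\mu]\in\hat{\mathfrak n}$, and the tangential component $\tau^{\tan}_{|\gamma(t)}$ of the tension field $\tau=\sum_i\bigl({}^{\psi}\nabla_{e_i}(d\psi\,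 e_i)-d\psi(\nabla_{e_i}e_i)\bigr)$ of $\psi$ (where the $e_i$ form a local orthonormal frame of $M$), i.e. the orthogonal projection of $\tau_{|\gamma(t)}$ to $T_{\hat\gamma(r(t))}(K\cdot\hat\gamma(r(t)))$, is given by $$\tau^{\tan}_{|\gamma(t)}=\Bigl(\hat P_{r(t)}^{-1}\sum_{\mu=1}^n\,[dA_eE_\mu,\hat P_{r(t)}\,dA_eE_\mu]\Bigr)^{\ast}_{|\hat\gamma(r(t))}.$$ -/

import Mathlib

open Bundle FiberBundle VectorField Module
open scoped Manifold ContDiff Topology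

noncomputable section
namespace CohomOne
section LeviCivita

variable {E : Type*} [NormedAddCommGroup E] [NormedSpace ℝ E]
  {M : Type*} [TopologicalSpace M] [ChartedSpace E M] [IsManifold 𝓘(ℝ, E) ∞ M]
  [RiemannianBundle (fun x : M ↦ TangentSpace 𝓘(ℝ, E) x)]
  [IsContMDiffRiemannianBundle 𝓘(ℝ, E) ∞ E (fun x : M ↦ TangentSpace 𝓘(ℝ, E) x)]

theorem mdifferentiableAt_inner {X Y : Π x : M, TangentSpace 𝓘(ℝ, E) x} {x : M}
    (hX : MDiffAt (T% X) x) (hY : MDiffAt (T% Y) x) :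
    MDiffAt (fun y ↦ inner ℝ (X y) (Y y)) x :=
  MDifferentiableAt.inner_bundle (F := E) (E := fun x : M ↦ TangentSpace 𝓘(ℝ, E) x) hX hY

variable [FiniteDimensional ℝ E]

instance instFiniteDimensionalTangentSpace (x : M) :
    FiniteDimensional ℝ (TangentSpace 𝓘(ℝ, E) x) :=
  VectorBundle.finiteDimensional ℝ E (TangentSpace 𝓘(ℝ, E)) x

/-- The right-hand side of the Koszul formula for `2 ⟨∇_X Y, Z⟩` at `x`. -/
def koszul (X Y Z : Π x : M, TangentSpace 𝓘(ℝ, E) x) (x : M) : ℝ :=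
  mvfderiv 𝓘(ℝ, E) (fun y ↦ inner ℝ (Y y) (Z y)) x (X x)
    + mvfderiv 𝓘(ℝ, E) (fun y ↦ inner ℝ (X y) (Z y)) x (Y x)
    - mvfderiv 𝓘(ℝ, E) (fun y ↦ inner ℝ (X y) (Y y)) x (Z x)
    + inner ℝ (mlieBracket 𝓘(ℝ, E) X Y x) (Z x)
    - inner ℝ (mlieBracket 𝓘(ℝ, E) X Z x) (Y x)
    - inner ℝ (mlieBracket 𝓘(ℝ, E) Y Z x) (X x)

theorem tensorialAt_koszul_left {Y Z : Π x : M, TangentSpace 𝓘(ℝ, E) x} {x : M}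
    (hY : MDiffAt (T% Y) x) (hZ : MDiffAt (T% Z) x) :
    TensorialAt 𝓘(ℝ, E) E (fun X ↦ koszul X Y Z x) x where
  smul {f X} hf hX := by
    simp [koszul, mlieBracket_smul_left hf hX, inner_add_left, inner_smul_left,
      mvfderiv_fun_mul hf (mdifferentiableAt_inner hX hZ), mvfderiv_fun_mul hf (mdifferentiableAt_inner hX hY),
      inner_smul_right]
    ring
  add {X X'} hX hX' := by
    simp [koszul, mlieBracket_add_left hX hX', inner_add_left, inner_add_right,
      mvfderiv_fun_add (mdifferentiableAt_inner hX hZ) (mdifferentiableAt_inner hX' hZ),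
      mvfderiv_fun_add (mdifferentiableAt_inner hX hY) (mdifferentiableAt_inner hX' hY)]
    ring

theorem tensorialAt_koszul_right {X Y : Π x : M, TangentSpace 𝓘(ℝ, E) x} {x : M}
    (hX : MDiffAt (T% X) x) (hY : MDiffAt (T% Y) x) :
    TensorialAt 𝓘(ℝ, E) E (fun Z ↦ koszul X Y Z x) x where
  smul {f Z} hf hZ := by
    simp [koszul, mlieBracket_smul_right hf hZ, inner_add_left, inner_smul_left,
      mvfderiv_fun_mul hf (mdifferentiableAt_inner hX hZ), mvfderiv_fun_mul hf (mdifferentiableAt_inner hY hZ),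
      inner_smul_right]
    rw [real_inner_comm (X x) (Z x), real_inner_comm (Y x) (Z x)]
    ring
  add {Z Z'} hZ hZ' := by
    simp [koszul, mlieBracket_add_right hZ hZ', inner_add_left, inner_add_right,
      mvfderiv_fun_add (mdifferentiableAt_inner hX hZ) (mdifferentiableAt_inner hX hZ'),
      mvfderiv_fun_add (mdifferentiableAt_inner hY hZ) (mdifferentiableAt_inner hY hZ')]
    ring

open Classical in
/-- The bilinear form `(v, w) ↦ 2 ⟨∇_v Y, w⟩` at `x`, given by the Koszul formula. -/
def koszulForm (Y : Π x : M, TangentSpace 𝓘(ℝ, E) x) (x : M) :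
    TangentSpace 𝓘(ℝ, E) x →L[ℝ] TangentSpace 𝓘(ℝ, E) x →L[ℝ] ℝ :=
  if hY : MDiffAt (T% Y) x then
    TensorialAt.mkHom₂ (fun X Z ↦ koszul X Y Z x) x
      (fun _ hZ ↦ tensorialAt_koszul_left hY hZ) (fun _ hX ↦ tensorialAt_koszul_right hX hY)
  else 0

theorem koszulForm_apply {X Y Z : Π x : M, TangentSpace 𝓘(ℝ, E) x} {x : M}
    (hX : MDiffAt (T% X) x) (hY : MDiffAt (T% Y) x) (hZ : MDiffAt (T% Z) x) :
    koszulForm Y x (X x) (Z x) = koszul X Y Z x := by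
  rw [koszulForm, dif_pos hY, TensorialAt.mkHom₂_apply _ _ hX hZ]

/-- The vector field derivative `∇_v Y`, i.e. the vector with `2 ⟨∇_v Y, w⟩` given by the Koszul
formula for all `w`. -/
def leviCivitaFun (Y : Π x : M, TangentSpace 𝓘(ℝ, E) x) (x : M) :
    TangentSpace 𝓘(ℝ, E) x →L[ℝ] TangentSpace 𝓘(ℝ, E) x :=
  ∑ i, ((1 / 2 : ℝ) • (koszulForm Y x).flip
    (stdOrthonormalBasis ℝ (TangentSpace 𝓘(ℝ, E) x) i)).smulRight
      (stdOrthonormalBasis ℝ (TangentSpace 𝓘(ℝ, E) x) i)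

theorem inner_leviCivitaFun (Y : Π x : M, TangentSpace 𝓘(ℝ, E) x) (x : M)
    (v w : TangentSpace 𝓘(ℝ, E) x) :
    inner ℝ (leviCivitaFun Y x v) w = 1 / 2 * koszulForm Y x v w := by
  conv_rhs => rw [← (stdOrthonormalBasis ℝ (TangentSpace 𝓘(ℝ, E) x)).sum_repr' w]
  simp [leviCivitaFun, sum_inner, inner_smul_left, Finset.mul_sum]
  refine Finset.sum_congr rfl fun i _ ↦ by ring

theorem inner_leviCivitaFun_apply {X Y Z : Π x : M, TangentSpace 𝓘(ℝ, E) x} {x : M}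
    (hX : MDiffAt (T% X) x) (hY : MDiffAt (T% Y) x) (hZ : MDiffAt (T% Z) x) :
    inner ℝ (leviCivitaFun Y x (X x)) (Z x) = 1 / 2 * koszul X Y Z x := by
  rw [inner_leviCivitaFun, koszulForm_apply hX hY hZ]

theorem isCovariantDerivativeOn_leviCivitaFun :
    IsCovariantDerivativeOn E
      (leviCivitaFun : (Π x : M, TangentSpace 𝓘(ℝ, E) x) →
        Π x : M, TangentSpace 𝓘(ℝ, E) x →L[ℝ] TangentSpace 𝓘(ℝ, E) x) Set.univ where
  add {Y Y' x} hY hY' _ := by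
    ext v
    refine ext_inner_right ℝ fun w ↦ ?_
    have hv := mdifferentiableAt_extend 𝓘(ℝ, E) E v
    have hw := mdifferentiableAt_extend 𝓘(ℝ, E) E w
    have h1 := inner_leviCivitaFun_apply hv hY hw
    have h2 := inner_leviCivitaFun_apply hv hY' hw
    have h3 := inner_leviCivitaFun_apply hv (mdifferentiableAt_add_section hY hY') hw
    simp only [extend_apply_self] at h1 h2 h3
    rw [h3, add_apply, inner_add_left, h1, h2]
    simp [koszul, mlieBracket_add_left hY hY', mlieBracket_add_right hY hY', inner_add_left,
      inner_add_right,
      mvfderiv_fun_add (mdifferentiableAt_inner hY hw) (mdifferentiableAt_inner hY' hw),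
      mvfderiv_fun_add (mdifferentiableAt_inner hv hY) (mdifferentiableAt_inner hv hY')]
    ring
  leibniz {Y f x} hY hf _ := by
    ext v
    refine ext_inner_right ℝ fun w ↦ ?_
    have hv := mdifferentiableAt_extend 𝓘(ℝ, E) E v
    have hw := mdifferentiableAt_extend 𝓘(ℝ, E) E w
    have h1 := inner_leviCivitaFun_apply hv hY hw
    have h3 := inner_leviCivitaFun_apply hv (hf.smul_section hY) hw
    simp only [extend_apply_self] at h1 h3
    simp only [add_apply, inner_add_left, smul_apply,
      inner_smul_left, h1]
    refine h3.trans ?_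
    simp [koszul, mlieBracket_smul_left hf hY, mlieBracket_smul_right hf hY, inner_add_left,
      inner_smul_left, inner_smul_right,
      mvfderiv_fun_mul hf (mdifferentiableAt_inner hY hw),
      mvfderiv_fun_mul hf (mdifferentiableAt_inner hv hY)]
    rw [real_inner_comm v (Y x)]
    ring

variable (E M) in
/-- The Levi-Civita connection of the Riemannian manifold `M`. -/
def leviCivita : CovariantDerivative 𝓘(ℝ, E) E (fun x : M ↦ TangentSpace 𝓘(ℝ, E) x) where
  toFun := leviCivitaFun
  isCovariantDerivativeOnUniv := isCovariantDerivativeOn_leviCivitaFun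

theorem torsion_leviCivita : (leviCivita E M).torsion = 0 := by
  rw [CovariantDerivative.torsion_eq_zero_iff]
  intro X Y x hX hY
  refine ext_inner_right ℝ fun w ↦ ?_
  have hw := mdifferentiableAt_extend 𝓘(ℝ, E) E w
  have h1 := inner_leviCivitaFun_apply hX hY hw
  have h2 := inner_leviCivitaFun_apply hY hX hw
  simp only [extend_apply_self] at h1 h2
  rw [inner_sub_left]
  refine (congrArg₂ (· - ·) h1 h2).trans ?_
  simp only [koszul, extend_apply_self, mlieBracket_swap_apply (V := Y) (W := X), inner_neg_left,
    real_inner_comm (X _) (Y _)]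
  ring

theorem mvfderiv_inner_leviCivita {X Y Z : Π x : M, TangentSpace 𝓘(ℝ, E) x} {x : M}
    (hX : MDiffAt (T% X) x) (hY : MDiffAt (T% Y) x) (hZ : MDiffAt (T% Z) x) :
    mvfderiv 𝓘(ℝ, E) (fun y ↦ inner ℝ (Y y) (Z y)) x (X x) =
      inner ℝ (leviCivita E M Y x (X x)) (Z x) + inner ℝ (Y x) (leviCivita E M Z x (X x)) := by
  have h1 := inner_leviCivitaFun_apply hX hY hZ
  have h2 := inner_leviCivitaFun_apply hX hZ hY
  rw [real_inner_comm] at h2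
  refine Eq.trans ?_ (congrArg₂ (· + ·) h1 h2).symm
  simp only [koszul, mlieBracket_swap_apply (V := Z) (W := Y), inner_neg_left,
    real_inner_comm (Y _) (Z _)]
  ring

end LeviCivita

section Tension

variable {E : Type*} [NormedAddCommGroup E] [NormedSpace ℝ E]
  {M : Type*} [TopologicalSpace M] [ChartedSpace E M] [IsManifold 𝓘(ℝ, E) ∞ M]
  {E' : Type*} [NormedAddCommGroup E'] [NormedSpace ℝ E']
  {N : Type*} [TopologicalSpace N] [ChartedSpace E' N] [IsManifold 𝓘(ℝ, E') ∞ N]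

/-- The pull-back connection `φ∇` on `φ⁻¹TN`. If `V` is a section of `φ⁻¹TN` and
`V = ∑ Vⁱ (∂ᵢ ∘ φ)` in the coordinate frame `∂ᵢ` of `TN` at `φ p`, then
`φ∇_v V = ∑ (dVⁱ(v) ∂ᵢ + Vⁱ ∇_{dφ v} ∂ᵢ)` at `p`. Here `extend E' (V p)` is the vector field with
constant coefficients `Vⁱ(p)` in that frame. -/
def pullbackConnection
    (cov : CovariantDerivative 𝓘(ℝ, E') E' (fun y : N ↦ TangentSpace 𝓘(ℝ, E') y))
    (φ : M → N) (V : Π x : M, TangentSpace 𝓘(ℝ, E') (φ x)) (p : M) :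
    TangentSpace 𝓘(ℝ, E) p →L[ℝ] TangentSpace 𝓘(ℝ, E') (φ p) :=
  let e := trivializationAt E' (TangentSpace 𝓘(ℝ, E') : N → Type _) (φ p)
  (e.symmL ℝ (φ p)).comp
      (mvfderiv 𝓘(ℝ, E) (fun x ↦ (e (⟨φ x, V x⟩ : TangentBundle 𝓘(ℝ, E') N)).2) p)
    + (cov (extend E' (V p)) (φ p)).comp (mfderiv 𝓘(ℝ, E) 𝓘(ℝ, E') φ p)

variable [FiniteDimensional ℝ E] [FiniteDimensional ℝ E']
  [RiemannianBundle (fun x : M ↦ TangentSpace 𝓘(ℝ, E) x)]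
  [IsContMDiffRiemannianBundle 𝓘(ℝ, E) ∞ E (fun x : M ↦ TangentSpace 𝓘(ℝ, E) x)]
  [RiemannianBundle (fun x : N ↦ TangentSpace 𝓘(ℝ, E') x)]
  [IsContMDiffRiemannianBundle 𝓘(ℝ, E') ∞ E' (fun x : N ↦ TangentSpace 𝓘(ℝ, E') x)]

/-- `∇dφ(v, w) = φ∇_v (dφ W) - dφ(∇_v W)` at `p`, where the vector field `W` extends `w`. -/
def secondFundamentalForm (φ : M → N) (p : M) (v w : TangentSpace 𝓘(ℝ, E) p) :
    TangentSpace 𝓘(ℝ, E') (φ p) :=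
  pullbackConnection (leviCivita E' N) φ
      (fun x ↦ mfderiv 𝓘(ℝ, E) 𝓘(ℝ, E') φ x (extend E w x)) p v
    - mfderiv 𝓘(ℝ, E) 𝓘(ℝ, E') φ p (leviCivita E M (extend E w) p v)

/-- The tension field `τ(φ) = ∑ ∇dφ(eᵢ, eᵢ)`, for an orthonormal basis `eᵢ` of `T_p M`. -/
def tensionField (φ : M → N) (p : M) : TangentSpace 𝓘(ℝ, E') (φ p) :=
  ∑ i, secondFundamentalForm φ p
    (stdOrthonormalBasis ℝ (TangentSpace 𝓘(ℝ, E) p) i)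
    (stdOrthonormalBasis ℝ (TangentSpace 𝓘(ℝ, E) p) i)

end Tension

section Geodesic

variable {E : Type*} [NormedAddCommGroup E] [NormedSpace ℝ E]
  {M : Type*} [TopologicalSpace M] [ChartedSpace E M]

/-- The velocity `γ'(t)` of a curve `γ`. -/
def velocity (γ : ℝ → M) (t : ℝ) : TangentSpace 𝓘(ℝ, E) (γ t) :=
  mfderiv 𝓘(ℝ, ℝ) 𝓘(ℝ, E) γ t (1 : ℝ)

/-- A geodesic `γ : ℝ → M`: a smooth curve with `∇_{γ'} γ' = 0`. -/
structure IsGeodesic [FiniteDimensional ℝ E] [IsManifold 𝓘(ℝ, E) ∞ M]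
    [RiemannianBundle (fun x : M ↦ TangentSpace 𝓘(ℝ, E) x)]
    [IsContMDiffRiemannianBundle 𝓘(ℝ, E) ∞ E (fun x : M ↦ TangentSpace 𝓘(ℝ, E) x)]
    (γ : ℝ → M) : Prop where
  contMDiff : ContMDiff 𝓘(ℝ, ℝ) 𝓘(ℝ, E) ∞ γ
  acceleration_eq_zero : ∀ t : ℝ,
    pullbackConnection (E := ℝ) (leviCivita E M) γ (velocity γ) t (1 : ℝ) = 0

end Geodesic

section LieGroup

variable {F : Type*} [NormedAddCommGroup F] [NormedSpace ℝ F]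
  {G : Type*} [TopologicalSpace G] [ChartedSpace F G] [Group G]

/-- The Lie algebra of a closed subgroup `H` of a Lie group `G`, as a subset of the Lie algebra of
`G`: the velocities at the identity of the curves in `G` which run in `H`. -/
def subgroupLieAlgebra (H : Subgroup G) : Set (GroupLieAlgebra 𝓘(ℝ, F) G) :=
  {X | ∃ c : ℝ → G, c 0 = 1 ∧ (∀ s, c s ∈ H) ∧ MDifferentiableAt 𝓘(ℝ, ℝ) 𝓘(ℝ, F) c 0 ∧
    (⟨c 0, velocity c 0⟩ : TangentBundle 𝓘(ℝ, F) G) = ⟨1, X⟩}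

variable [LieGroup 𝓘(ℝ, F) ∞ G]

/-- A Riemannian metric on `G` is biinvariant if all left and right translations are isometries. -/
structure IsBiinvariant
    (Q : ContMDiffRiemannianMetric 𝓘(ℝ, F) ∞ F (fun g : G ↦ TangentSpace 𝓘(ℝ, F) g)) : Prop where
  left : ∀ (a g : G) (v w : TangentSpace 𝓘(ℝ, F) g),
    Q.inner (a * g) (mfderiv 𝓘(ℝ, F) 𝓘(ℝ, F) (fun x : G ↦ a * x) g v)
      (mfderiv 𝓘(ℝ, F) 𝓘(ℝ, F) (fun x : G ↦ a * x) g w) = Q.inner g v w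
  right : ∀ (a g : G) (v w : TangentSpace 𝓘(ℝ, F) g),
    Q.inner (g * a) (mfderiv 𝓘(ℝ, F) 𝓘(ℝ, F) (fun x : G ↦ x * a) g v)
      (mfderiv 𝓘(ℝ, F) 𝓘(ℝ, F) (fun x : G ↦ x * a) g w) = Q.inner g v w

/-- The `Q`-orthogonal complement of the Lie algebra of `H` in the Lie algebra of `G`. -/
def lieComplement
    (Q : ContMDiffRiemannianMetric 𝓘(ℝ, F) ∞ F (fun g : G ↦ TangentSpace 𝓘(ℝ, F) g))
    (H : Subgroup G) : Submodule ℝ (GroupLieAlgebra 𝓘(ℝ, F) G) where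
  carrier := {Y | ∀ X ∈ subgroupLieAlgebra (F := F) H, Q.inner 1 X Y = 0}
  add_mem' hY hY' X hX := by rw [map_add, hY X hX, hY' X hX, add_zero]
  zero_mem' X _ := map_zero _
  smul_mem' c Y hY X hX := by rw [map_smul, hY X hX, smul_zero]

/-- The restriction of `Q` to a subspace `n` of the Lie algebra of `G`. -/
def restrictForm
    (Q : ContMDiffRiemannianMetric 𝓘(ℝ, F) ∞ F (fun g : G ↦ TangentSpace 𝓘(ℝ, F) g))
    (n : Submodule ℝ (GroupLieAlgebra 𝓘(ℝ, F) G)) : LinearMap.BilinForm ℝ n :=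
  LinearMap.mk₂ ℝ (fun X Y : n ↦ Q.inner 1 X Y) (by simp) (by simp) (by simp) (by simp)

theorem nondegenerate_restrictForm
    (Q : ContMDiffRiemannianMetric 𝓘(ℝ, F) ∞ F (fun g : G ↦ TangentSpace 𝓘(ℝ, F) g))
    (n : Submodule ℝ (GroupLieAlgebra 𝓘(ℝ, F) G)) : (restrictForm Q n).Nondegenerate := by
  have key : ∀ X : n, restrictForm Q n X X = 0 → X = 0 := fun X hX ↦ by
    by_contra h
    exact (Q.pos 1 (X : GroupLieAlgebra 𝓘(ℝ, F) G) (by simpa using h)).ne' hX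
  exact ⟨fun X hX ↦ key X (hX X), fun X hX ↦ key X (hX X)⟩

variable [FiniteDimensional ℝ F]

instance instFiniteDimensionalGroupLieAlgebra :
    FiniteDimensional ℝ (GroupLieAlgebra 𝓘(ℝ, F) G) :=
  instFiniteDimensionalTangentSpace 1

/-- The `Q`-orthogonal projection of the Lie algebra of `G` onto a subspace `n`. -/
def lieProjection
    (Q : ContMDiffRiemannianMetric 𝓘(ℝ, F) ∞ F (fun g : G ↦ TangentSpace 𝓘(ℝ, F) g))
    (n : Submodule ℝ (GroupLieAlgebra 𝓘(ℝ, F) G)) : GroupLieAlgebra 𝓘(ℝ, F) G →ₗ[ℝ] n :=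
  ((restrictForm Q n).toDual (nondegenerate_restrictForm Q n)).symm.toLinearMap ∘ₗ
    LinearMap.mk₂ ℝ (fun (X : GroupLieAlgebra 𝓘(ℝ, F) G) (Y : n) ↦ Q.inner 1 X Y)
      (by simp) (by simp) (by simp) (by simp)

theorem inner_lieProjection
    (Q : ContMDiffRiemannianMetric 𝓘(ℝ, F) ∞ F (fun g : G ↦ TangentSpace 𝓘(ℝ, F) g))
    (n : Submodule ℝ (GroupLieAlgebra 𝓘(ℝ, F) G)) (X : GroupLieAlgebra 𝓘(ℝ, F) G) (Y : n) :
    Q.inner 1 (lieProjection Q n X) Y = Q.inner 1 X Y :=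
  LinearMap.congr_fun (((restrictForm Q n).toDual
    (nondegenerate_restrictForm Q n)).apply_symm_apply _) Y

end LieGroup

section Action

variable {F : Type*} [NormedAddCommGroup F] [NormedSpace ℝ F]
  {G : Type*} [TopologicalSpace G] [ChartedSpace F G] [Group G]
  {E : Type*} [NormedAddCommGroup E] [NormedSpace ℝ E]
  {M : Type*} [TopologicalSpace M] [ChartedSpace E M] [MulAction G M]

/-- The linear map `X ↦ X*(p)` from the Lie algebra of `G` to `T_p M`, where `X*` is the action
field of `X`. It is the differential at the identity of the orbit map `g ↦ g • p`. -/
def actionField (p : M) : GroupLieAlgebra 𝓘(ℝ, F) G →L[ℝ] TangentSpace 𝓘(ℝ, E) p :=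
  mfderiv 𝓘(ℝ, F) 𝓘(ℝ, E) (fun g : G ↦ g • p) 1

variable (F G) in
/-- The tangent space at `p` of the orbit `G • p`. -/
def orbitTangent (p : M) : Submodule ℝ (TangentSpace 𝓘(ℝ, E) p) :=
  LinearMap.range (actionField (F := F) (G := G) p).toLinearMap

variable (F G E) in
/-- The orbit of `p` has codimension one in `M`. -/
def IsNonsingularPoint (p : M) : Prop :=
  finrank ℝ (orbitTangent F G (E := E) p) + 1 = finrank ℝ E

variable (F G E M) in
/-- An isometric action for which the orbits of largest dimension have codimension one, i.e. for
which the orbit space is one-dimensional. -/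
structure IsCohomogeneityOneAction
    [RiemannianBundle (fun x : M ↦ TangentSpace 𝓘(ℝ, E) x)] : Prop where
  isometric : ∀ (g : G) (p : M) (v w : TangentSpace 𝓘(ℝ, E) p),
    inner ℝ (mfderiv 𝓘(ℝ, E) 𝓘(ℝ, E) (fun x : M ↦ g • x) p v)
      (mfderiv 𝓘(ℝ, E) 𝓘(ℝ, E) (fun x : M ↦ g • x) p w) = inner ℝ v w
  finrank_orbitTangent_lt : ∀ p : M, finrank ℝ (orbitTangent F G (E := E) p) < finrank ℝ E
  exists_nonsingular : ∃ p : M, IsNonsingularPoint F G E p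

variable (F G E) in
/-- A unit-speed geodesic that passes through all orbits perpendicularly. -/
structure IsUnitSpeedNormalGeodesic [IsManifold 𝓘(ℝ, E) ∞ M] [FiniteDimensional ℝ E]
    [RiemannianBundle (fun x : M ↦ TangentSpace 𝓘(ℝ, E) x)]
    [IsContMDiffRiemannianBundle 𝓘(ℝ, E) ∞ E (fun x : M ↦ TangentSpace 𝓘(ℝ, E) x)]
    (γ : ℝ → M) : Prop extends IsGeodesic (E := E) γ where
  norm_velocity : ∀ t, ‖velocity (E := E) γ t‖ = 1
  perpendicular : ∀ (t : ℝ) (X : GroupLieAlgebra 𝓘(ℝ, F) G),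
    inner ℝ (actionField (E := E) (γ t) X) (velocity γ t) = 0
  meets_orbits : ∀ p : M, ∃ (g : G) (t : ℝ), g • γ t = p

variable [RiemannianBundle (fun x : M ↦ TangentSpace 𝓘(ℝ, E) x)]
  [LieGroup 𝓘(ℝ, F) ∞ G] [FiniteDimensional ℝ F]

variable (E) in
/-- The metric endomorphism `P` of `n` at `p`, determined by `Q(X, P Y) = ⟨X*, Y*⟩_p` for all
`X, Y` in `n`. -/
def metricEndomorphism
    (Q : ContMDiffRiemannianMetric 𝓘(ℝ, F) ∞ F (fun g : G ↦ TangentSpace 𝓘(ℝ, F) g))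
    (n : Submodule ℝ (GroupLieAlgebra 𝓘(ℝ, F) G)) (p : M) : n →ₗ[ℝ] n :=
  ((restrictForm Q n).toDual (nondegenerate_restrictForm Q n)).symm.toLinearMap ∘ₗ
    LinearMap.mk₂ ℝ (fun X Y : n ↦ inner ℝ (actionField (E := E) p (X : GroupLieAlgebra 𝓘(ℝ, F) G))
        (actionField (E := E) p (Y : GroupLieAlgebra 𝓘(ℝ, F) G)))
      (by simp [inner_add_left]) (by simp [inner_smul_left])
      (by simp [inner_add_right]) (by simp [inner_smul_right])

theorem inner_metricEndomorphism
    (Q : ContMDiffRiemannianMetric 𝓘(ℝ, F) ∞ F (fun g : G ↦ TangentSpace 𝓘(ℝ, F) g))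
    (n : Submodule ℝ (GroupLieAlgebra 𝓘(ℝ, F) G)) (p : M) (X Y : n) :
    Q.inner 1 X (metricEndomorphism E Q n p Y) =
      inner ℝ (actionField (E := E) p (X : GroupLieAlgebra 𝓘(ℝ, F) G))
        (actionField (E := E) p (Y : GroupLieAlgebra 𝓘(ℝ, F) G)) := by
  rw [Q.symm, real_inner_comm]
  exact LinearMap.congr_fun (((restrictForm Q n).toDual
    (nondegenerate_restrictForm Q n)).apply_symm_apply _) X

end Action

section EquivariantMap

variable {F : Type*} [NormedAddCommGroup F] [NormedSpace ℝ F]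
  {G : Type*} [TopologicalSpace G] [ChartedSpace F G] [Group G]
  {F' : Type*} [NormedAddCommGroup F'] [NormedSpace ℝ F']
  {K : Type*} [TopologicalSpace K] [ChartedSpace F' K] [Group K]

/-- The differential at the identity of a homomorphism of Lie groups. -/
def lieDifferential (A : G →* K) :
    GroupLieAlgebra 𝓘(ℝ, F) G →L[ℝ] GroupLieAlgebra 𝓘(ℝ, F') K :=
  mfderiv 𝓘(ℝ, F) 𝓘(ℝ, F') A 1

end EquivariantMap

section Tangential

variable {E : Type*} [NormedAddCommGroup E] [NormedSpace ℝ E] [FiniteDimensional ℝ E]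
  {M : Type*} [TopologicalSpace M] [ChartedSpace E M] [IsManifold 𝓘(ℝ, E) ∞ M]
  [RiemannianBundle (fun x : M ↦ TangentSpace 𝓘(ℝ, E) x)]
  [IsContMDiffRiemannianBundle 𝓘(ℝ, E) ∞ E (fun x : M ↦ TangentSpace 𝓘(ℝ, E) x)]
  {E' : Type*} [NormedAddCommGroup E'] [NormedSpace ℝ E'] [FiniteDimensional ℝ E']
  {N : Type*} [TopologicalSpace N] [ChartedSpace E' N] [IsManifold 𝓘(ℝ, E') ∞ N]
  [RiemannianBundle (fun x : N ↦ TangentSpace 𝓘(ℝ, E') x)]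
  [IsContMDiffRiemannianBundle 𝓘(ℝ, E') ∞ E' (fun x : N ↦ TangentSpace 𝓘(ℝ, E') x)]
  (F' : Type*) [NormedAddCommGroup F'] [NormedSpace ℝ F']
  (K : Type*) [TopologicalSpace K] [ChartedSpace F' K] [Group K] [MulAction K N]

variable (E E') in
/-- The tangential component of the tension field of `φ` at `p`: its orthogonal projection onto
the tangent space of the orbit `K • φ p`. -/
def tangentialTensionField (φ : M → N) (p : M) : TangentSpace 𝓘(ℝ, E') (φ p) :=
  (orbitTangent F' K (E := E') (φ p)).starProjection (tensionField (E := E) φ p)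

end Tangential
end CohomOne
end

open CohomOne

/-!
Let `p = γ t`, let `τ` be the tension field of `ψ` at `p` and let `W_μ = dA X_μ`. Since the action
fields `Z*`, for `Z` in the Lie algebra of `K`, span the tangent space of the orbit of `ψ p`, the
tangential component of `τ` is determined by the numbers `⟨Z*, τ⟩`. They are computed from the
orthonormal basis `γ', X_1*, …, X_n*` of `T_p M`.

For a vector field `Z` on `N`, the metric product rule `mvfderiv_inner_along` gives
`⟨Z, ∇dψ(v, V)⟩ = v ⟨Z ∘ ψ, dψ V⟩ - ⟨Z, dψ (∇_v V)⟩ - ⟨∇_{dψ v} Z, dψ V⟩`.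
The right-hand side, `sffForm`, is tensorial in `V`, so that `V` may be any vector field with the
prescribed value at `p`, and any orthonormal basis may be used (`inner_tensionField`).

* In the direction of `γ'` the form vanishes (`sffForm_velocity`): `ψ` maps `γ` to a
  reparametrization of the second geodesic, which is orthogonal to `Z*`.
* For `V = X*` and `W = dA X` (`sffForm_actionField`), the function `⟨Z*, dψ X*⟩` equals
  `⟨Z*, W*⟩ ∘ ψ` along the orbit of `p`, so its derivative is `-⟨W*, [W, Z]*⟩`; the last term
  vanishes because `Z*` is a Killing field.
* The remaining term is `⟨Z*, dψ H⟩` with `H = ∑ ∇_{X_μ*} X_μ*`. Here `⟨H, Y*⟩` is the trace of the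
  compression of `ad Y` to `𝔫`, which is skew for the biinvariant metric. So `H` is a multiple of
  `γ'`, and `dψ H` is orthogonal to `Z*`.

Hence `⟨Z*, τ⟩ = -∑ ⟨W_μ*, [W_μ, Z]*⟩`, and by biinvariance this is `Q'(∑ [W_μ, P' W_μ], Z)`, which
is `⟨(P'⁻¹ S)*, Z*⟩` for the sum `S` of these brackets. That `S` lies in `𝔫'` follows by
differentiating `⟨W*, W*⟩` in the direction of the isotropy algebra.

The facts on action fields rest on two brackets: `[W*, X*] = -[W, X]*`, and `[W^L, Z^R] = 0` for a
left-invariant and a right-invariant field, which says that `Ad(g⁻¹) X` has the derivative `-[W, X]`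
at the identity (`mvfderiv_adInv`). Isometry of the action turns this into a formula for
the derivatives of `⟨X*, Y*⟩`.
-/

/-! ### Vector fields and their brackets as derivations -/

section LieBracketCalculus

variable {E : Type*} [NormedAddCommGroup E] [NormedSpace ℝ E]
  {H : Type*} [TopologicalSpace H] {I : ModelWithCorners ℝ E H}
  {M : Type*} [TopologicalSpace M] [ChartedSpace H M]
  {E' : Type*} [NormedAddCommGroup E'] [NormedSpace ℝ E']
  {H' : Type*} [TopologicalSpace H'] {I' : ModelWithCorners ℝ E' H'}
  {N : Type*} [TopologicalSpace N] [ChartedSpace H' N]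
  {E'' : Type*} [NormedAddCommGroup E''] [NormedSpace ℝ E'']

theorem MDifferentiableAt.mfderiv_section [IsManifold I 1 M] [IsManifold I' 1 N]
    {f : M → N} {W : Π x : M, TangentSpace I x} {x : M}
    (hf : ContMDiffAt I I' 2 f x) (hW : MDiffAt (T% W) x) :
    MDiffAt (fun y ↦ (⟨f y, mfderiv I I' f y (W y)⟩ : TangentBundle I' N)) x := by
  have h1 := (hf.mfderiv_const (m := 1) (by norm_num)).mdifferentiableAt one_ne_zero
  exact MDifferentiableAt.clm_apply_of_inCoordinates (b₁ := id) (b₂ := f) (F₁ := E) (F₂ := E')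
    (E₁ := TangentSpace I) (E₂ := TangentSpace I') h1 hW (hf.mdifferentiableAt two_ne_zero)

theorem MDifferentiableAt.mvfderiv_section [IsManifold I 1 M]
    {f : M → E'} {W : Π x : M, TangentSpace I x} {x : M}
    (hf : ContMDiffAt I 𝓘(ℝ, E') 2 f x) (hW : MDiffAt (T% W) x) :
    MDiffAt (fun y ↦ mvfderiv I f y (W y)) x :=
  ((contMDiff_snd_tangentBundle_modelSpace (n := 1) E' 𝓘(ℝ, E')).mdifferentiableAt
    one_ne_zero).comp x (MDifferentiableAt.mfderiv_section hf hW)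

theorem ContMDiffAt.eventually_mdifferentiableAt [IsManifold I 2 M] [IsManifold I' 2 N]
    {f : M → N} {x : M} (hf : ContMDiffAt I I' 2 f x) : ∀ᶠ y in 𝓝 x, MDiffAt f y :=
  ((contMDiffAt_iff_contMDiffAt_nhds (by simp)).1 hf).mono
    fun _ hy ↦ hy.mdifferentiableAt two_ne_zero

/-- If `U'` is `f`-related to `U`, then `(U' φ) ∘ f = U (φ ∘ f)` near `x`; this is the derivative of
that identity at `x`. -/
theorem mvfderiv_mvfderiv_of_related [IsManifold I ∞ M] [IsManifold I' ∞ N]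
    {f : M → N} {φ : N → E''} {U : Π x : M, TangentSpace I x} {U' : Π x : N, TangentSpace I' x}
    {x : M} (hf : ContMDiffAt I I' 2 f x) (hφ : ContMDiffAt I' 𝓘(ℝ, E'') 2 φ (f x))
    (hU' : MDiffAt (T% U') (f x)) (h : ∀ᶠ y in 𝓝 x, U' (f y) = mfderiv I I' f y (U y))
    (u : TangentSpace I x) :
    mvfderiv I' (fun z ↦ mvfderiv I' φ z (U' z)) (f x) (mfderiv I I' f x u) =
      mvfderiv I (fun z ↦ mvfderiv I (φ ∘ f) z (U z)) x u := by
  have hc : (fun z ↦ mvfderiv I (φ ∘ f) z (U z)) =ᶠ[𝓝 x]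
      (fun z ↦ mvfderiv I' φ z (U' z)) ∘ f := by
    filter_upwards [hf.continuousAt.eventually hφ.eventually_mdifferentiableAt,
      hf.eventually_mdifferentiableAt, h] with z hz₁ hz₂ hz
    rw [Function.comp_apply, hz]
    exact mfderiv_comp_apply (g := φ) z hz₁ hz₂ _
  have h1 := mfderiv_comp_apply (g := fun z ↦ mvfderiv I' φ z (U' z)) x
    (MDifferentiableAt.mvfderiv_section hφ hU') (hf.mdifferentiableAt two_ne_zero) u
  have h2 := hc.mfderiv_eq (I := I) (I' := 𝓘(ℝ, E''))
  exact h1.symm.trans (congrArg (fun L : E →L[ℝ] E'' ↦ L u) h2.symm)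

variable [CompleteSpace E]

/-- The bracket as a commutator, computed in the model space through a local parametrization `χ`.
Making `χ` and `y` variables lets the base point be the literal expression `χ y`. -/
theorem mvfderiv_apply_mlieBracket_of_parametrization [IsManifold I ∞ M]
    {f : M → E'} {V W : Π x : M, TangentSpace I x} {χ : E → M} {y : E}
    (hf : ContMDiffAt I 𝓘(ℝ, E') 2 f (χ y)) (hV : MDiffAt (T% V) (χ y)) (hW : MDiffAt (T% W) (χ y))
    (hχ : ContMDiffAt 𝓘(ℝ, E) I 2 χ y)
    (hinv : ∀ᶠ z in 𝓝 y, (mfderiv 𝓘(ℝ, E) I χ z).IsInvertible) :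
    mvfderiv I f (χ y) (mlieBracket I V W (χ y)) =
      mvfderiv I (fun z ↦ mvfderiv I f z (W z)) (χ y) (V (χ y))
        - mvfderiv I (fun z ↦ mvfderiv I f z (V z)) (χ y) (W (χ y)) := by
  have : IsManifold I (minSmoothness ℝ 2) M := by
    rw [minSmoothness_of_isRCLikeNormedField]; infer_instance
  have hy := hinv.self_of_nhds
  have hχd : MDiffAt χ y := hχ.mdifferentiableAt two_ne_zero
  have hfd : MDiffAt f (χ y) := hf.mdifferentiableAt two_ne_zero
  have hfχ : ContDiffAt ℝ 2 (f ∘ χ) y := (hf.comp y hχ).contDiffAt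
  have key := mpullback_mlieBracket (n := 2) hV hW hχ (by simp)
  have hpull (U : Π x : M, TangentSpace I x) (hU : MDiffAt (T% U) (χ y)) :
      DifferentiableAt ℝ (mpullback 𝓘(ℝ, E) I χ U : E → E) y :=
    (((contMDiff_snd_tangentBundle_modelSpace (n := 1) E 𝓘(ℝ, E)).mdifferentiableAt
      one_ne_zero).comp y (hU.mpullback_vectorField hχ hy le_rfl)).differentiableAt
  have hval (U : Π x : M, TangentSpace I x) : ∀ᶠ z in 𝓝 y,
      mfderiv 𝓘(ℝ, E) I χ z (mpullback 𝓘(ℝ, E) I χ U z) = U (χ z) :=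
    hinv.mono fun z hz ↦ hz.self_apply_inverse _
  have hev : ∀ᶠ z in 𝓝 y, MDiffAt f (χ z) ∧ MDiffAt χ z := by
    exact (hχ.continuousAt.eventually hf.eventually_mdifferentiableAt).and
      hχ.eventually_mdifferentiableAt
  have hcomp (U : Π x : M, TangentSpace I x) : ∀ᶠ z in 𝓝 y,
      fderiv ℝ (f ∘ χ) z (mpullback 𝓘(ℝ, E) I χ U z) = mvfderiv I f (χ z) (U (χ z)) := by
    filter_upwards [hev, hval U] with z hz hz'
    rw [← hz', ← mfderiv_eq_fderiv]
    exact mfderiv_comp_apply z hz.1 hz.2 _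
  have hder (U U' : Π x : M, TangentSpace I x) (hU : MDiffAt (T% U) (χ y)) :
      fderiv ℝ (fun z ↦ fderiv ℝ (f ∘ χ) z (mpullback 𝓘(ℝ, E) I χ U z)) y
        (mpullback 𝓘(ℝ, E) I χ U' y) =
      mvfderiv I (fun z ↦ mvfderiv I f z (U z)) (χ y) (U' (χ y)) := by
    rw [Filter.EventuallyEq.fderiv_eq (hcomp U), ← (hval U').self_of_nhds, ← mfderiv_eq_fderiv]
    exact mfderiv_comp_apply (g := fun z ↦ mvfderiv I f z (U z)) y
      (MDifferentiableAt.mvfderiv_section hf hU) hχd _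
  have h2 := fderiv_apply_lieBracket (f := f ∘ χ) (n := 2) hfχ (by simp) (hpull W hW) (hpull V hV)
  rw [hder W V hW, hder V W hV] at h2
  rw [← h2, ← (hval (mlieBracket I V W)).self_of_nhds, key]
  rw [← mlieBracketWithin_univ, mlieBracketWithin_eq_lieBracketWithin, ← mfderiv_eq_fderiv]
  refine (mfderiv_comp_apply (g := f) y hfd hχd _).symm.trans ?_
  exact congrArg (fun u ↦ mfderiv 𝓘(ℝ, E) 𝓘(ℝ, E') (f ∘ χ) y u)
    (congrFun (lieBracketWithin_univ (𝕜 := ℝ) (E := E)) y)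

/-- The bracket of vector fields is the commutator of the derivations which they define. -/
theorem mvfderiv_apply_mlieBracket [IsManifold I ∞ M] [I.Boundaryless]
    {f : M → E'} {V W : Π x : M, TangentSpace I x} {x : M}
    (hf : ContMDiffAt I 𝓘(ℝ, E') 2 f x) (hV : MDiffAt (T% V) x) (hW : MDiffAt (T% W) x) :
    mvfderiv I f x (mlieBracket I V W x) =
      mvfderiv I (fun z ↦ mvfderiv I f z (W z)) x (V x)
        - mvfderiv I (fun z ↦ mvfderiv I f z (V z)) x (W x) := by
  have h0 : (extChartAt I x).symm (extChartAt I x x) = x := extChartAt_to_inv x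
  have hχ : ContMDiffAt 𝓘(ℝ, E) I 2 (extChartAt I x).symm (extChartAt I x x) :=
    (contMDiffOn_extChartAt_symm x).contMDiffAt (extChartAt_target_mem_nhds x)
  have hinv : ∀ᶠ z in 𝓝 (extChartAt I x x),
      (mfderiv 𝓘(ℝ, E) I (extChartAt I x).symm z).IsInvertible := by
    filter_upwards [extChartAt_target_mem_nhds (I := I) x] with z hz
    have := isInvertible_mfderivWithin_extChartAt_symm (I := I) hz
    rwa [I.range_eq_univ, mfderivWithin_univ] at this
  generalize ((extChartAt I x).symm : E → M) = χ at h0 hχ hinv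
  generalize extChartAt I x x = y at h0 hχ hinv
  subst h0
  exact mvfderiv_apply_mlieBracket_of_parametrization hf hV hW hχ hinv

/-- The brackets of `f`-related vector fields are `f`-related. -/
theorem mlieBracket_of_related [IsManifold I ∞ M] [I.Boundaryless] [IsManifold I' ∞ N]
    [I'.Boundaryless] [CompleteSpace E']
    {f : M → N} {V W : Π x : M, TangentSpace I x} {V' W' : Π x : N, TangentSpace I' x} {x : M}
    (hf : ContMDiffAt I I' 2 f x) (hV : MDiffAt (T% V) x) (hW : MDiffAt (T% W) x)
    (hV' : MDiffAt (T% V') (f x)) (hW' : MDiffAt (T% W') (f x))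
    (hVV' : ∀ᶠ y in 𝓝 x, V' (f y) = mfderiv I I' f y (V y))
    (hWW' : ∀ᶠ y in 𝓝 x, W' (f y) = mfderiv I I' f y (W y)) :
    mlieBracket I' V' W' (f x) = mfderiv I I' f x (mlieBracket I V W x) := by
  have h (φ : N → E') (hφ : ContMDiffAt I' 𝓘(ℝ, E') 2 φ (f x)) :
      mvfderiv I' φ (f x) (mlieBracket I' V' W' (f x)) =
        mvfderiv I' φ (f x) (mfderiv I I' f x (mlieBracket I V W x)) := by
    have h1 := mvfderiv_apply_mlieBracket hφ hV' hW'
    have h2 := mvfderiv_apply_mlieBracket (hφ.comp x hf) hV hW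
    rw [hVV'.self_of_nhds, hWW'.self_of_nhds, mvfderiv_mvfderiv_of_related hf hφ hW' hWW',
      mvfderiv_mvfderiv_of_related hf hφ hV' hVV', ← h2] at h1
    exact h1.trans (mfderiv_comp_apply (g := φ) x (hφ.mdifferentiableAt two_ne_zero)
      (hf.mdifferentiableAt two_ne_zero) _)
  exact (isInvertible_mfderiv_extChartAt (I := I') (mem_extChartAt_source (f x))).injective
    (h _ contMDiffAt_extChartAt)

end LieBracketCalculus

/-! ### Derivatives along a map and the pull-back connection -/

section ProductRule

variable {E : Type*} [NormedAddCommGroup E] [NormedSpace ℝ E]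
  {M : Type*} [TopologicalSpace M] [ChartedSpace E M]
  {E' : Type*} [NormedAddCommGroup E'] [NormedSpace ℝ E'] [FiniteDimensional ℝ E']
  {N : Type*} [TopologicalSpace N] [ChartedSpace E' N] [IsManifold 𝓘(ℝ, E') ∞ N]

theorem mvfderiv_fun_sum_apply {ι : Type*} (s : Finset ι) {f : ι → M → ℝ} {p : M}
    (h : ∀ i, MDiffAt (f i) p) (v : TangentSpace 𝓘(ℝ, E) p) :
    mvfderiv 𝓘(ℝ, E) (fun x ↦ ∑ i ∈ s, f i x) p v = ∑ i ∈ s, mvfderiv 𝓘(ℝ, E) (f i) p v := by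
  classical
  suffices hs : MDiffAt (fun x ↦ ∑ i ∈ s, f i x) p ∧ mvfderiv 𝓘(ℝ, E) (fun x ↦ ∑ i ∈ s, f i x) p v =
      ∑ i ∈ s, mvfderiv 𝓘(ℝ, E) (f i) p v from hs.2
  induction s using Finset.induction_on with
  | empty => simpa [mvfderiv_const] using mdifferentiableAt_const
  | insert a s ha ih =>
    simp only [Finset.sum_insert ha]
    refine ⟨(h a).add ih.1, ?_⟩
    rw [mvfderiv_fun_add (h a) ih.1, ← ih.2, add_apply]

/-- The product rule for a one-form along `φ` in the coordinate frame of `TN` at `φ p`, before any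
connection is chosen: `V` is differentiated through its coordinates `Vⁱ`. -/
theorem mvfderiv_oneForm_along {φ : M → N} {V : Π x : M, TangentSpace 𝓘(ℝ, E') (φ x)} {p : M}
    (hV : MDiffAt (fun x ↦ (⟨φ x, V x⟩ : TangentBundle 𝓘(ℝ, E') N)) p)
    {α : Π y : N, TangentSpace 𝓘(ℝ, E') y →ₗ[ℝ] ℝ}
    (hα : ∀ u : TangentSpace 𝓘(ℝ, E') (φ p), MDiffAt (fun y ↦ α y (extend E' u y)) (φ p))
    (v : TangentSpace 𝓘(ℝ, E) p) :
    mvfderiv 𝓘(ℝ, E) (fun x ↦ α (φ x) (V x)) p v =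
      mvfderiv 𝓘(ℝ, E') (fun y ↦ α y (extend E' (V p) y)) (φ p) (mfderiv 𝓘(ℝ, E) 𝓘(ℝ, E') φ p v)
      + α (φ p) ((trivializationAt E' (TangentSpace 𝓘(ℝ, E') : N → Type _) (φ p)).symmL ℝ (φ p)
        (mvfderiv 𝓘(ℝ, E) (fun x ↦ (trivializationAt E' (TangentSpace 𝓘(ℝ, E') : N → Type _) (φ p)
          (⟨φ x, V x⟩ : TangentBundle 𝓘(ℝ, E') N)).2) p v)) := by
  set e := trivializationAt E' (TangentSpace 𝓘(ℝ, E') : N → Type _) (φ p) with he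
  obtain ⟨hφ, hVc⟩ := (mdifferentiableAt_totalSpace _ _).1 hV
  change MDiffAt φ p at hφ
  change MDiffAt (fun x ↦ (e ⟨φ x, V x⟩).2) p at hVc
  set c : M → E' := fun x ↦ (e ⟨φ x, V x⟩).2 with hc
  have hp : φ p ∈ e.baseSet := mem_baseSet_trivializationAt' (φ p)
  let b := Module.finBasis ℝ E'
  let g (i) (y : N) : ℝ := α y (e.symm y (b i))
  have hsum {y : N} (hy : y ∈ e.baseSet) (w : E') :
      α y (e.symm y w) = ∑ i, b.repr w i * g i y := by
    rw [← e.coe_symmₗ (R := ℝ) hy]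
    conv_lhs => rw [← b.sum_repr w, map_sum, map_sum]
    simp only [map_smul, smul_eq_mul, g, e.coe_symmₗ (R := ℝ) hy]
  -- the frame fields `∂ᵢ` are themselves extensions with constant coefficients
  have hgd (i) : MDiffAt (g i) (φ p) := by
    have := hα (e.symm (φ p) (b i))
    simp only [extend] at this
    simpa only [← he, e.apply_mk_symm hp] using! this
  have hbase := hφ.continuousAt.eventually (e.open_baseSet.mem_nhds hp)
  have hev : (fun x ↦ α (φ x) (V x)) =ᶠ[𝓝 p] fun x ↦ ∑ i, b.repr (c x) i * g i (φ x) := by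
    filter_upwards [hbase] with x hx
    rw [← hsum hx, hc, e.symm_apply_apply_mk hx]
  have hev' : (fun y ↦ α y (extend E' (V p) y)) =ᶠ[𝓝 (φ p)]
      fun y ↦ ∑ i, b.repr (c p) i * g i y := by
    filter_upwards [e.open_baseSet.mem_nhds hp] with y hy
    exact hsum hy _
  have hcd (i) : MDiffAt (fun x ↦ b.repr (c x) i) p :=
    (b.coord i).toContinuousLinearMap.differentiableAt.mdifferentiableAt.comp p hVc
  have hcd' (i) : mvfderiv 𝓘(ℝ, E) (fun x ↦ b.repr (c x) i) p v =
      b.repr (mvfderiv 𝓘(ℝ, E) c p v) i := by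
    refine (mfderiv_comp_apply (g := (b.coord i).toContinuousLinearMap) p
      (b.coord i).toContinuousLinearMap.differentiableAt.mdifferentiableAt hVc v).trans ?_
    rw [mfderiv_eq_fderiv, ContinuousLinearMap.fderiv]
    rfl
  have hgφ (i) : MDiffAt (fun x ↦ g i (φ x)) p := (hgd i).comp p hφ
  have hgφ' (i) : mvfderiv 𝓘(ℝ, E) (fun x ↦ g i (φ x)) p v =
      mvfderiv 𝓘(ℝ, E') (g i) (φ p) (mfderiv 𝓘(ℝ, E) 𝓘(ℝ, E') φ p v) :=
    mfderiv_comp_apply (g := g i) p (hgd i) hφ v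
  have h1 : mvfderiv 𝓘(ℝ, E) (fun x ↦ α (φ x) (V x)) p v =
      ∑ i, (b.repr (c p) i * mvfderiv 𝓘(ℝ, E') (g i) (φ p) (mfderiv 𝓘(ℝ, E) 𝓘(ℝ, E') φ p v)
        + b.repr (mvfderiv 𝓘(ℝ, E) c p v) i * g i (φ p)) := by
    refine (congrArg (fun L : E →L[ℝ] ℝ ↦ L v)
      (hev.mfderiv_eq (I := 𝓘(ℝ, E)) (I' := 𝓘(ℝ, ℝ)))).trans
      ((mvfderiv_fun_sum_apply _ (fun i ↦ (hcd i).mul (hgφ i)) v).trans ?_)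
    refine Finset.sum_congr rfl fun i _ ↦ ?_
    rw [mvfderiv_mul (hcd i) (hgφ i)]
    simp only [add_apply, smul_apply, smul_eq_mul, hcd', hgφ']
    ring
  have h2 (w : TangentSpace 𝓘(ℝ, E') (φ p)) :
      mvfderiv 𝓘(ℝ, E') (fun y ↦ α y (extend E' (V p) y)) (φ p) w =
      ∑ i, b.repr (c p) i * mvfderiv 𝓘(ℝ, E') (g i) (φ p) w := by
    refine (congrArg (fun L : E' →L[ℝ] ℝ ↦ L w)
      (hev'.mfderiv_eq (I := 𝓘(ℝ, E')) (I' := 𝓘(ℝ, ℝ)))).trans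
      ((mvfderiv_fun_sum_apply _ (fun i ↦ mdifferentiableAt_const.mul (hgd i)) w).trans ?_)
    refine Finset.sum_congr rfl fun i _ ↦ ?_
    rw [mvfderiv_mul mdifferentiableAt_const (hgd i)]
    simp [mvfderiv_const]
  rw [h1, h2, e.symmL_apply hp, hsum hp, Finset.sum_add_distrib]

/-- The product rule for a one-form `α` on `N` and a section `V` of `φ⁻¹TN`:
`v (α V) = (∇_{dφ v} α) V + α (φ∇_v V)`. The term `(∇_w α) u = w (α U) - α (∇_w U)` is written with
the extension `U` of `u` with constant coefficients. -/
theorem mvfderiv_oneForm_along_eq_pullbackConnection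
    (cov : CovariantDerivative 𝓘(ℝ, E') E' (fun y : N ↦ TangentSpace 𝓘(ℝ, E') y))
    {φ : M → N} {V : Π x : M, TangentSpace 𝓘(ℝ, E') (φ x)} {p : M}
    (hV : MDiffAt (fun x ↦ (⟨φ x, V x⟩ : TangentBundle 𝓘(ℝ, E') N)) p)
    {α : Π y : N, TangentSpace 𝓘(ℝ, E') y →ₗ[ℝ] ℝ}
    (hα : ∀ u : TangentSpace 𝓘(ℝ, E') (φ p), MDiffAt (fun y ↦ α y (extend E' u y)) (φ p))
    (v : TangentSpace 𝓘(ℝ, E) p) :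
    mvfderiv 𝓘(ℝ, E) (fun x ↦ α (φ x) (V x)) p v =
      mvfderiv 𝓘(ℝ, E') (fun y ↦ α y (extend E' (V p) y)) (φ p) (mfderiv 𝓘(ℝ, E) 𝓘(ℝ, E') φ p v)
      - α (φ p) (cov (extend E' (V p)) (φ p) (mfderiv 𝓘(ℝ, E) 𝓘(ℝ, E') φ p v))
      + α (φ p) (pullbackConnection cov φ V p v) := by
  rw [mvfderiv_oneForm_along hV hα, pullbackConnection, add_apply,
    map_add]
  simp only [ContinuousLinearMap.comp_apply]
  ring

/-- The pull-back of the Levi-Civita connection is metric. -/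
theorem mvfderiv_inner_along [RiemannianBundle (fun x : N ↦ TangentSpace 𝓘(ℝ, E') x)]
    [IsContMDiffRiemannianBundle 𝓘(ℝ, E') ∞ E' (fun x : N ↦ TangentSpace 𝓘(ℝ, E') x)]
    {φ : M → N} {V : Π x : M, TangentSpace 𝓘(ℝ, E') (φ x)} {p : M}
    (hV : MDiffAt (fun x ↦ (⟨φ x, V x⟩ : TangentBundle 𝓘(ℝ, E') N)) p)
    {Z : Π y : N, TangentSpace 𝓘(ℝ, E') y} (hZ : MDiffAt (T% Z) (φ p))
    (v : TangentSpace 𝓘(ℝ, E) p) :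
    mvfderiv 𝓘(ℝ, E) (fun x ↦ inner ℝ (Z (φ x)) (V x)) p v =
      inner ℝ (leviCivita E' N Z (φ p) (mfderiv 𝓘(ℝ, E) 𝓘(ℝ, E') φ p v)) (V p)
      + inner ℝ (Z (φ p)) (pullbackConnection (leviCivita E' N) φ V p v) := by
  have h1 := mvfderiv_oneForm_along_eq_pullbackConnection (leviCivita E' N) hV
    (α := fun y ↦ innerₛₗ ℝ (Z y))
    (fun u ↦ mdifferentiableAt_inner hZ (mdifferentiableAt_extend 𝓘(ℝ, E') E' u)) v
  have h2 := mvfderiv_inner_leviCivita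
    (mdifferentiableAt_extend 𝓘(ℝ, E') E' (mfderiv 𝓘(ℝ, E) 𝓘(ℝ, E') φ p v)) hZ
    (mdifferentiableAt_extend 𝓘(ℝ, E') E' (V p))
  simp only [extend_apply_self] at h2
  simp only [innerₛₗ_apply_apply] at h1
  rw [h1, h2]
  ring

end ProductRule

/-! ### Action fields -/

section ActionFields

variable {F : Type*} [NormedAddCommGroup F] [NormedSpace ℝ F]
  {G : Type*} [TopologicalSpace G] [ChartedSpace F G] [Group G]
  {E : Type*} [NormedAddCommGroup E] [NormedSpace ℝ E]
  {M : Type*} [TopologicalSpace M] [ChartedSpace E M]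
  [MulAction G M] [ContMDiffSMul 𝓘(ℝ, F) 𝓘(ℝ, E) ∞ G M]

theorem contMDiff_orbitMap (p : M) : ContMDiff 𝓘(ℝ, F) 𝓘(ℝ, E) ∞ (fun g : G ↦ g • p) :=
  contMDiff_id.smul contMDiff_const

theorem mdifferentiableAt_orbitMap (p : M) (g : G) :
    MDifferentiableAt 𝓘(ℝ, F) 𝓘(ℝ, E) (fun g : G ↦ g • p) g :=
  (contMDiff_orbitMap p).mdifferentiable (by simp) g

variable [LieGroup 𝓘(ℝ, F) ∞ G]

/-- Action fields are related to right-invariant fields under orbit maps. -/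
theorem mfderiv_orbitMap_actionField (p : M) (g : G) (X : GroupLieAlgebra 𝓘(ℝ, F) G) :
    mfderiv 𝓘(ℝ, F) 𝓘(ℝ, E) (fun g : G ↦ g • p) g (actionField (E := F) g X) =
      (actionField (g • p) X : TangentSpace 𝓘(ℝ, E) (g • p)) := by
  have h : (fun h : G ↦ h • g • p) = (fun g : G ↦ g • p) ∘ fun h : G ↦ h • g := by
    funext h; simp [mul_smul]
  have h1 : MDifferentiableAt 𝓘(ℝ, F) 𝓘(ℝ, F) (fun h : G ↦ h • g) 1 :=
    mdifferentiableAt_orbitMap g 1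
  have h2 := mfderiv_comp_apply_of_eq (I' := 𝓘(ℝ, F)) (y := g) (1 : G)
    (mdifferentiableAt_orbitMap (E := E) p g) h1 (one_smul G g) X
  rw [← h] at h2
  exact h2.symm

/-- The left translation by `g` maps `X*(p)` to the image of the left-invariant field of `X` under
the orbit map of `p`. -/
theorem mfderiv_smul_actionField (p : M) (g : G) (X : GroupLieAlgebra 𝓘(ℝ, F) G) :
    mfderiv 𝓘(ℝ, E) 𝓘(ℝ, E) (fun x : M ↦ g • x) p (actionField p X) =
      mfderiv 𝓘(ℝ, F) 𝓘(ℝ, E) (fun g : G ↦ g • p) g (mulInvariantVectorField X g) := by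
  have h : (fun x : M ↦ g • x) ∘ (fun h : G ↦ h • p) = (fun g : G ↦ g • p) ∘ fun h : G ↦ g * h := by
    funext h; simp [mul_smul]
  have h1 : MDifferentiableAt 𝓘(ℝ, F) 𝓘(ℝ, F) (fun h : G ↦ g * h) 1 :=
    contMDiff_mul_left.contMDiffAt.mdifferentiableAt (n := ∞) (by simp)
  have h2 := mfderiv_comp_apply_of_eq (I' := 𝓘(ℝ, F)) (y := g) (1 : G)
    (mdifferentiableAt_orbitMap (E := E) p g) h1 (mul_one g) X
  have h3 : MDifferentiableAt 𝓘(ℝ, E) 𝓘(ℝ, E) (fun x : M ↦ g • x) p :=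
    ContMDiff.mdifferentiable (ContMDiffSMul.contMDiff_const_smul (I := 𝓘(ℝ, F)) g) (n := ∞)
      (by simp) p
  have h4 := mfderiv_comp_apply_of_eq (I' := 𝓘(ℝ, E)) (y := p) (1 : G)
    h3 (mdifferentiableAt_orbitMap (E := E) p 1) (one_smul G p) X
  rw [h] at h4
  exact h4.symm.trans h2

theorem mfderiv_mul_left_mulInvariantVectorField (g h : G) (X : GroupLieAlgebra 𝓘(ℝ, F) G) :
    mfderiv 𝓘(ℝ, F) 𝓘(ℝ, F) (fun x : G ↦ g * x) h (mulInvariantVectorField X h) =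
      mulInvariantVectorField X (g * h) := by
  have h0 : (fun x : G ↦ g * h * x) = (fun x : G ↦ g * x) ∘ fun x : G ↦ h * x := by
    funext x; simp [mul_assoc]
  have h1 (g h : G) : MDifferentiableAt 𝓘(ℝ, F) 𝓘(ℝ, F) (fun h : G ↦ g * h) h :=
    contMDiff_mul_left.contMDiffAt.mdifferentiableAt (n := ∞) (by simp)
  have h2 := mfderiv_comp_apply_of_eq (I' := 𝓘(ℝ, F)) (y := h) (1 : G) (h1 g h) (h1 h 1)
    (mul_one h) X
  rw [← h0] at h2
  exact h2.symm

variable [IsManifold 𝓘(ℝ, E) ∞ M]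

theorem mdifferentiableAt_actionField (X : GroupLieAlgebra 𝓘(ℝ, F) G) (p : M) :
    MDiffAt (fun x ↦ (⟨x, actionField x X⟩ : TangentBundle 𝓘(ℝ, E) M)) p := by
  have hs : ContMDiffAt (𝓘(ℝ, E).prod 𝓘(ℝ, F)) 𝓘(ℝ, E) 2
      (Function.uncurry fun (x : M) (g : G) ↦ g • x) (p, 1) :=
    (contMDiff_snd.smul contMDiff_fst).contMDiffAt
  have h1 := (ContMDiffAt.mfderiv (m := 1) (fun (x : M) (g : G) ↦ g • x) (fun _ ↦ (1 : G))
    hs contMDiffAt_const (by norm_num)).mdifferentiableAt one_ne_zero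
  have h2 := MDifferentiableAt.clm_apply_of_inCoordinates (b₁ := fun _ : M ↦ (1 : G))
    (b₂ := fun x : M ↦ (1 : G) • x) (F₁ := F) (F₂ := E) (v := fun _ ↦ X)
    (E₁ := TangentSpace 𝓘(ℝ, F)) (E₂ := TangentSpace 𝓘(ℝ, E)) h1
    (mdifferentiableAt_const (I := 𝓘(ℝ, E)) (I' := 𝓘(ℝ, F).tangent)
      (c := (⟨1, X⟩ : TangentBundle 𝓘(ℝ, F) G)))
    (mdifferentiableAt_id.congr_of_eventuallyEq (.of_forall fun x : M ↦ one_smul G x))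
  -- `h2` has the base point `1 • x`, which is only propositionally equal to `x`
  refine h2.congr_of_eventuallyEq (.of_forall fun x ↦ ?_)
  have (y : M) (hy : x = y) (v : E) :
    (⟨x, v⟩ : TangentBundle 𝓘(ℝ, E) M) = ⟨y, v⟩ := by subst hy; rfl
  exact this _ (one_smul G x).symm _

/-- Right-invariant and left-invariant vector fields commute: they are the images, under the
multiplication `G × G → G`, of fields tangent to the two factors. -/
theorem mlieBracket_actionField_mulInvariantVectorField [CompleteSpace F]
    (W Z : GroupLieAlgebra 𝓘(ℝ, F) G) :
    mlieBracket 𝓘(ℝ, F) (fun g : G ↦ actionField (E := F) g Z)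
      (mulInvariantVectorField W) 1 = 0 := by
  have : LieGroup 𝓘(ℝ, F) (minSmoothness ℝ 3) G := by
    rw [minSmoothness_of_isRCLikeNormedField]; infer_instance
  -- on `G` acting on itself, the action field of `Z` is the right-invariant field of `Z`
  let V₁ : Π x : G × G, TangentSpace (𝓘(ℝ, F).prod 𝓘(ℝ, F)) x := fun x ↦
    (actionField (E := F) x.1 Z, (0 : F))
  let V₂ : Π x : G × G, TangentSpace (𝓘(ℝ, F).prod 𝓘(ℝ, F)) x := fun x ↦
    ((0 : F), mulInvariantVectorField W x.2)
  have hZ (g : G) := mdifferentiableAt_actionField (E := F) Z g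
  have hW (g : G) := mdifferentiableAt_mulInvariantVectorField W (g := g)
  have h0 (g : G) : MDiffAt (T% (0 : Π x : G, TangentSpace 𝓘(ℝ, F) x)) g :=
    mdifferentiable_zeroSection ℝ (TangentSpace 𝓘(ℝ, F)) g
  have hV₁ : MDiffAt (T% V₁) (1, 1) :=
    MDifferentiableAt.comp (I' := (𝓘(ℝ, F).tangent.prod 𝓘(ℝ, F).tangent)) ((1 : G), (1 : G))
      ((contMDiff_equivTangentBundleProd_symm (n := 1)).mdifferentiableAt one_ne_zero)
      ((MDifferentiableAt.comp (f := Prod.fst) ((1 : G), (1 : G)) (hZ 1)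
        mdifferentiableAt_fst).prodMk
        (MDifferentiableAt.comp (f := Prod.snd) ((1 : G), (1 : G)) (h0 1) mdifferentiableAt_snd))
  have hV₂ : MDiffAt (T% V₂) (1, 1) :=
    MDifferentiableAt.comp (I' := (𝓘(ℝ, F).tangent.prod 𝓘(ℝ, F).tangent)) ((1 : G), (1 : G))
      ((contMDiff_equivTangentBundleProd_symm (n := 1)).mdifferentiableAt one_ne_zero)
      ((MDifferentiableAt.comp (f := Prod.fst) ((1 : G), (1 : G)) (h0 1)
        mdifferentiableAt_fst).prodMk
        (MDifferentiableAt.comp (f := Prod.snd) ((1 : G), (1 : G)) (hW 1) mdifferentiableAt_snd))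
  have hfst := mlieBracket_of_related (f := Prod.fst) (V := V₁) (W := V₂)
    (V' := fun g ↦ actionField (E := F) g Z) (W' := 0)
    contMDiffAt_fst hV₁ hV₂ (hZ 1) (h0 1) (.of_forall fun _ ↦ by rw [mfderiv_fst]; rfl)
    (.of_forall fun _ ↦ by rw [mfderiv_fst]; rfl)
  have hsnd := mlieBracket_of_related (f := Prod.snd) (V := V₁) (W := V₂)
    (V' := 0) (W' := mulInvariantVectorField W)
    contMDiffAt_snd hV₁ hV₂ (h0 1) (hW 1) (.of_forall fun _ ↦ by rw [mfderiv_snd]; rfl)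
    (.of_forall fun _ ↦ by rw [mfderiv_snd]; rfl)
  -- both projections of the bracket vanish
  have hzero : mlieBracket (𝓘(ℝ, F).prod 𝓘(ℝ, F)) V₁ V₂ ((1 : G), (1 : G)) = 0 := by
    rw [mlieBracket_zero_right, mfderiv_fst] at hfst
    rw [mlieBracket_zero_left, mfderiv_snd] at hsnd
    exact Prod.ext hfst.symm hsnd.symm
  have hm (x : G × G) : MDifferentiableAt (𝓘(ℝ, F).prod 𝓘(ℝ, F)) 𝓘(ℝ, F)
      (fun x : G × G ↦ x.1 * x.2) x :=
    (contMDiff_mul 𝓘(ℝ, F) ∞).mdifferentiable (by simp) x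
  have hmul := mlieBracket_of_related (f := fun x : G × G ↦ x.1 * x.2) (x := (1, 1)) (V := V₁)
    (W := V₂) (V' := fun g ↦ actionField (E := F) g Z) (W' := mulInvariantVectorField W)
    ((contMDiff_mul 𝓘(ℝ, F) 2).contMDiffAt) hV₁ hV₂ (hZ _) (hW _) ?_ ?_
  · rw [hzero, map_zero] at hmul
    rw [one_mul] at hmul
    exact hmul
  · refine .of_forall fun x ↦ ?_
    rw [mfderiv_prod_eq_add_apply (hm x)]
    refine Eq.trans ?_ (congrArg₂ (· + ·) (mfderiv_orbitMap_actionField (E := F) x.2 x.1 Z)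
      (map_zero (mfderiv 𝓘(ℝ, F) 𝓘(ℝ, F) (fun z : G ↦ x.1 * z) x.2))).symm
    exact (add_zero _).symm
  · refine .of_forall fun x ↦ ?_
    rw [mfderiv_prod_eq_add_apply (hm x)]
    refine Eq.trans ?_ (congrArg₂ (· + ·)
      (map_zero (mfderiv 𝓘(ℝ, F) 𝓘(ℝ, F) (fun z : G ↦ z * x.2) x.1))
      (mfderiv_mul_left_mulInvariantVectorField x.1 x.2 W)).symm
    exact (zero_add _).symm

end ActionFields

/-! ### The adjoint action and brackets of action fields -/

section Adjoint

variable {F : Type*} [NormedAddCommGroup F] [NormedSpace ℝ F]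
  {G : Type*} [TopologicalSpace G] [ChartedSpace F G] [Group G]

/-- The adjoint action `Ad(g⁻¹)` on the Lie algebra. -/
noncomputable def adInv (g : G) : GroupLieAlgebra 𝓘(ℝ, F) G →L[ℝ] GroupLieAlgebra 𝓘(ℝ, F) G :=
  mfderiv 𝓘(ℝ, F) 𝓘(ℝ, F) (fun h : G ↦ g⁻¹ * h * g) 1

theorem adInv_one (X : GroupLieAlgebra 𝓘(ℝ, F) G) : adInv 1 X = X := by
  have : (fun h : G ↦ (1 : G)⁻¹ * h * 1) = id := by funext h; simp
  rw [adInv, this, mfderiv_id]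
  rfl

theorem mulInvariantVectorField_one (X : GroupLieAlgebra 𝓘(ℝ, F) G) :
    mulInvariantVectorField X (1 : G) = X := by
  have : (fun h : G ↦ 1 * h) = id := by funext h; simp
  rw [mulInvariantVectorField, this, mfderiv_id]
  rfl

theorem actionField_one (X : GroupLieAlgebra 𝓘(ℝ, F) G) :
    actionField (E := F) (1 : G) X = X := by
  have : (fun h : G ↦ h • (1 : G)) = id := by funext h; simp
  rw [actionField, this, mfderiv_id]
  rfl

variable [LieGroup 𝓘(ℝ, F) ∞ G]

/-- On `G` acting on itself, the right-invariant field of `X` at `g` is the left-invariant field of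
`Ad(g⁻¹) X`. -/
theorem actionField_eq_mulInvariantVectorField (g : G) (X : GroupLieAlgebra 𝓘(ℝ, F) G) :
    actionField (E := F) g X = mulInvariantVectorField (adInv g X) g := by
  have h : (fun h : G ↦ h • g) = (fun h : G ↦ g * h) ∘ fun h : G ↦ g⁻¹ * h * g := by
    funext h; simp [mul_assoc]
  have h1 : MDifferentiableAt 𝓘(ℝ, F) 𝓘(ℝ, F) (fun h : G ↦ g * h) 1 :=
    contMDiff_mul_left.contMDiffAt.mdifferentiableAt (n := ∞) (by simp)
  have h2 : MDifferentiableAt 𝓘(ℝ, F) 𝓘(ℝ, F) (fun h : G ↦ g⁻¹ * h * g) 1 :=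
    ((contMDiff_const.mul contMDiff_id).mul contMDiff_const).contMDiffAt.mdifferentiableAt
      (n := ∞) (by simp)
  have h3 := mfderiv_comp_apply_of_eq (1 : G) h1 h2 (by simp) X
  rw [← h] at h3
  exact h3

/-- `X*(g • p) = dg ((Ad(g⁻¹) X)*(p))`. -/
theorem actionField_smul {E : Type*} [NormedAddCommGroup E] [NormedSpace ℝ E]
    {M : Type*} [TopologicalSpace M] [ChartedSpace E M]
    [MulAction G M] [ContMDiffSMul 𝓘(ℝ, F) 𝓘(ℝ, E) ∞ G M]
    (g : G) (p : M) (X : GroupLieAlgebra 𝓘(ℝ, F) G) :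
    actionField (E := E) (g • p) X =
      mfderiv 𝓘(ℝ, E) 𝓘(ℝ, E) (fun x : M ↦ g • x) p (actionField p (adInv g X)) := by
  rw [mfderiv_smul_actionField, ← mfderiv_orbitMap_actionField,
    actionField_eq_mulInvariantVectorField]

theorem mdifferentiableAt_adInv [FiniteDimensional ℝ F] (X : GroupLieAlgebra 𝓘(ℝ, F) G)
    (ℓ : GroupLieAlgebra 𝓘(ℝ, F) G →ₗ[ℝ] ℝ) (g : G) : MDiffAt (fun g : G ↦ ℓ (adInv g X)) g := by
  have hs : ContMDiffAt (𝓘(ℝ, F).prod 𝓘(ℝ, F)) 𝓘(ℝ, F) 2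
      (Function.uncurry fun (g : G) (h : G) ↦ g⁻¹ * h * g) (g, 1) :=
    ((contMDiff_fst.inv.mul contMDiff_snd).mul contMDiff_fst).contMDiffAt
  have h1 := (ContMDiffAt.mfderiv (m := 1) (fun (g : G) (h : G) ↦ g⁻¹ * h * g) (fun _ ↦ (1 : G))
    hs contMDiffAt_const (by norm_num)).mdifferentiableAt one_ne_zero
  have h2 := MDifferentiableAt.clm_apply_of_inCoordinates (b₁ := fun _ : G ↦ (1 : G))
    (b₂ := fun g : G ↦ g⁻¹ * 1 * g) (F₁ := F) (F₂ := F) (v := fun _ ↦ X)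
    (E₁ := TangentSpace 𝓘(ℝ, F)) (E₂ := TangentSpace 𝓘(ℝ, F)) h1
    (mdifferentiableAt_const (I := 𝓘(ℝ, F)) (I' := 𝓘(ℝ, F).tangent)
      (c := (⟨1, X⟩ : TangentBundle 𝓘(ℝ, F) G)))
    ((mdifferentiableAt_const (I := 𝓘(ℝ, F)) (I' := 𝓘(ℝ, F)) (c := (1 : G))).congr_of_eventuallyEq
      (.of_forall fun g : G ↦ by simp))
  have h3 : MDiffAt (fun g ↦ (⟨1, adInv g X⟩ : TangentBundle 𝓘(ℝ, F) G)) g := by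
    refine h2.congr_of_eventuallyEq (.of_forall fun x ↦ ?_)
    have (y : G) (hy : 1 = y) (v : F) :
      (⟨1, v⟩ : TangentBundle 𝓘(ℝ, F) G) = ⟨y, v⟩ := by subst hy; rfl
    exact this _ (by simp) _
  have h4 := ((mdifferentiableAt_totalSpace _ _).1 h3).2
  set e := trivializationAt F (TangentSpace 𝓘(ℝ, F)) (1 : G)
  have he : (1 : G) ∈ e.baseSet := mem_baseSet_trivializationAt' 1
  have h5 := (LinearMap.toContinuousLinearMap (ℓ ∘ₗ (e.symmL ℝ (1 : G)).toLinearMap)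
    ).differentiableAt.mdifferentiableAt.comp g h4
  refine h5.congr_of_eventuallyEq (.of_forall fun x ↦ ?_)
  simp only [Function.comp_apply, LinearMap.coe_toContinuousLinearMap', LinearMap.comp_apply,
    ContinuousLinearMap.coe_coe, e.symmL_apply he, e.symm_apply_apply_mk he]

theorem mlieBracket_sum_right {ι : Type*} (s : Finset ι) {V : Π x : G, TangentSpace 𝓘(ℝ, F) x}
    {W : ι → Π x : G, TangentSpace 𝓘(ℝ, F) x} {x : G} [CompleteSpace F]
    (hW : ∀ i, MDiffAt (T% (W i)) x) :
    mlieBracket 𝓘(ℝ, F) V (fun y ↦ ∑ i ∈ s, W i y) x = ∑ i ∈ s, mlieBracket 𝓘(ℝ, F) V (W i) x := by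
  classical
  induction s using Finset.induction_on with
  | empty =>
    simp only [Finset.sum_empty]
    exact congrFun (mlieBracket_zero_right (I := 𝓘(ℝ, F))) x
  | insert a s ha ih =>
    simp only [Finset.sum_insert ha]
    rw [← ih]
    exact mlieBracket_add_right (hW a) (.sum_section fun i _ ↦ hW i)

variable [FiniteDimensional ℝ F]

/-- The right-invariant field of `X` is `∑ ℓⁱ(Ad(g⁻¹) X) b_i` for the left-invariant fields of a
basis `b`, with dual basis `ℓ`. This is the Leibniz rule for that sum. -/
theorem mlieBracket_actionField_eq_sum (V : Π x : G, TangentSpace 𝓘(ℝ, F) x)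
    (X : GroupLieAlgebra 𝓘(ℝ, F) G) {ι : Type*} [Fintype ι]
    (b : Basis ι ℝ (GroupLieAlgebra 𝓘(ℝ, F) G)) :
    mlieBracket 𝓘(ℝ, F) V (fun g : G ↦ actionField (E := F) g X) 1 =
      ∑ i, (mvfderiv 𝓘(ℝ, F) (fun g ↦ b.coord i (adInv g X)) 1 (V 1) • b i
        + b.coord i X • mlieBracket 𝓘(ℝ, F) V (mulInvariantVectorField (b i)) 1) := by
  have : LieGroup 𝓘(ℝ, F) (minSmoothness ℝ 3) G := by
    rw [minSmoothness_of_isRCLikeNormedField]; infer_instance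
  have h : (fun g : G ↦ actionField (E := F) g X) =
      fun g ↦ ∑ i, ((fun g ↦ b.coord i (adInv g X)) • mulInvariantVectorField (b i)) g := by
    funext g
    rw [actionField_eq_mulInvariantVectorField]
    conv_lhs => rw [← b.sum_repr (adInv g X)]
    simp only [mulInvariantVectorField, map_sum, map_smul]
    rfl
  have hd (i) := mdifferentiableAt_mulInvariantVectorField (b i) (g := 1)
  have hf (i) := mdifferentiableAt_adInv X (b.coord i) 1
  rw [h, mlieBracket_sum_right _ fun i ↦ (hf i).smul_section (hd i)]
  refine Finset.sum_congr rfl fun i _ ↦ ?_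
  rw [mlieBracket_smul_right (hf i) (hd i), mulInvariantVectorField_one, adInv_one]

/-- For the left-invariant field `V` of `W`, the left-hand side of `mlieBracket_actionField_eq_sum`
vanishes and the brackets on its right-hand side are those of the Lie algebra. -/
theorem sum_mvfderiv_adInv (W X : GroupLieAlgebra 𝓘(ℝ, F) G) {ι : Type*} [Fintype ι]
    (b : Basis ι ℝ (GroupLieAlgebra 𝓘(ℝ, F) G)) :
    ∑ i, mvfderiv 𝓘(ℝ, F) (fun g ↦ b.coord i (adInv g X)) 1 W • b i = - ⁅W, X⁆ := by
  have : LieGroup 𝓘(ℝ, F) (minSmoothness ℝ 3) G := by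
    rw [minSmoothness_of_isRCLikeNormedField]; infer_instance
  have h := mlieBracket_actionField_eq_sum (mulInvariantVectorField W) X b
  rw [mlieBracket_swap_apply, mlieBracket_actionField_mulInvariantVectorField, neg_zero,
    Finset.sum_add_distrib, mulInvariantVectorField_one] at h
  rw [eq_neg_iff_add_eq_zero, h]
  congr 1
  conv_lhs => rw [← b.sum_repr X, lie_sum]
  simp only [lie_smul]
  rfl

/-- The derivative of `g ↦ Ad(g⁻¹) X` at the identity in the direction `W` is `-[W, X]`. -/
theorem mvfderiv_adInv (W X : GroupLieAlgebra 𝓘(ℝ, F) G) (ℓ : GroupLieAlgebra 𝓘(ℝ, F) G →ₗ[ℝ] ℝ) :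
    mvfderiv 𝓘(ℝ, F) (fun g ↦ ℓ (adInv g X)) 1 W = - ℓ ⁅W, X⁆ := by
  let b := finBasis ℝ (GroupLieAlgebra 𝓘(ℝ, F) G)
  have h : (fun g ↦ ℓ (adInv g X)) = fun g ↦ ∑ i, b.coord i (adInv g X) * ℓ (b i) := by
    funext g
    conv_lhs => rw [← b.sum_repr (adInv g X)]
    simp only [map_sum, map_smul]
    rfl
  have hf (i) := mdifferentiableAt_adInv X (b.coord i) 1
  rw [h, mvfderiv_fun_sum_apply (f := fun i g ↦ b.coord i (adInv g X) * ℓ (b i)) _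
    (fun i ↦ (hf i).mul mdifferentiableAt_const),
    ← map_neg, ← sum_mvfderiv_adInv W X b, map_sum]
  refine Finset.sum_congr rfl fun i _ ↦ ?_
  rw [mvfderiv_fun_mul (hf i) mdifferentiableAt_const]
  simp [mvfderiv_const, mul_comm]

theorem mvfderiv_bilin_adInv (W X Y : GroupLieAlgebra 𝓘(ℝ, F) G)
    (β : GroupLieAlgebra 𝓘(ℝ, F) G →ₗ[ℝ] GroupLieAlgebra 𝓘(ℝ, F) G →ₗ[ℝ] ℝ) :
    mvfderiv 𝓘(ℝ, F) (fun g ↦ β (adInv g X) (adInv g Y)) 1 W = - β ⁅W, X⁆ Y - β X ⁅W, Y⁆ := by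
  let b := finBasis ℝ (GroupLieAlgebra 𝓘(ℝ, F) G)
  have hβ (U V) : β U V = ∑ i, b.coord i U * β (b i) V := by
    conv_lhs => rw [← b.sum_repr U]
    simp only [map_sum, map_smul, LinearMap.sum_apply]
    rfl
  have h : (fun g ↦ β (adInv g X) (adInv g Y)) =
      fun g ↦ ∑ i, b.coord i (adInv g X) * β (b i) (adInv g Y) := by
    funext g
    exact hβ _ _
  have hf (i) := mdifferentiableAt_adInv X (b.coord i) 1
  have hg (i) := mdifferentiableAt_adInv Y (β (b i)) 1
  rw [h, mvfderiv_fun_sum_apply (f := fun i g ↦ b.coord i (adInv g X) * β (b i) (adInv g Y)) _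
    (fun i ↦ (hf i).mul (hg i)), hβ, hβ X,
    ← Finset.sum_neg_distrib, ← Finset.sum_sub_distrib]
  refine Finset.sum_congr rfl fun i _ ↦ ?_
  rw [mvfderiv_fun_mul (hf i) (hg i)]
  simp only [add_apply, smul_apply, smul_eq_mul, mvfderiv_adInv, adInv_one]
  ring

variable {E : Type*} [NormedAddCommGroup E] [NormedSpace ℝ E]
  [CompleteSpace E] {M : Type*} [TopologicalSpace M] [ChartedSpace E M] [IsManifold 𝓘(ℝ, E) ∞ M]
  [MulAction G M] [ContMDiffSMul 𝓘(ℝ, F) 𝓘(ℝ, E) ∞ G M]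

/-- `X ↦ X*` is an antihomomorphism of Lie algebras. -/
theorem mlieBracket_actionField (p : M) (W X : GroupLieAlgebra 𝓘(ℝ, F) G) :
    mlieBracket 𝓘(ℝ, E) (fun x : M ↦ actionField (E := E) x W) (fun x ↦ actionField x X) p =
      - actionField p ⁅W, X⁆ := by
  have h1 : mlieBracket 𝓘(ℝ, F) (fun g : G ↦ actionField (E := F) g W)
      (fun g ↦ actionField g X) 1 = - ⁅W, X⁆ := by
    rw [mlieBracket_actionField_eq_sum _ X (finBasis ℝ _), ← sum_mvfderiv_adInv W X (finBasis ℝ _),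
      actionField_one]
    refine Finset.sum_congr rfl fun i _ ↦ ?_
    rw [mlieBracket_actionField_mulInvariantVectorField, smul_zero, add_zero]
  have h2 := mlieBracket_of_related (f := fun g : G ↦ g • p) (x := 1)
    (V := fun g : G ↦ actionField (E := F) g W) (W := fun g : G ↦ actionField (E := F) g X)
    (V' := fun x : M ↦ actionField (E := E) x W) (W' := fun x : M ↦ actionField (E := E) x X)
    ((contMDiff_orbitMap (F := F) p).contMDiffAt.of_le ENat.LEInfty.out)
    (mdifferentiableAt_actionField W 1) (mdifferentiableAt_actionField X 1)
    (mdifferentiableAt_actionField W _) (mdifferentiableAt_actionField X _)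
    (.of_forall fun g ↦ (mfderiv_orbitMap_actionField p g W).symm)
    (.of_forall fun g ↦ (mfderiv_orbitMap_actionField p g X).symm)
  rw [h1, one_smul] at h2
  exact h2.trans (map_neg (mfderiv 𝓘(ℝ, F) 𝓘(ℝ, E) (fun g : G ↦ g • p) 1) _)

end Adjoint

/-! ### Biinvariant metrics -/

section Biinvariant

variable {F : Type*} [NormedAddCommGroup F] [NormedSpace ℝ F]
  {G : Type*} [TopologicalSpace G] [ChartedSpace F G] [Group G] [LieGroup 𝓘(ℝ, F) ∞ G]
  {Q : ContMDiffRiemannianMetric 𝓘(ℝ, F) ∞ F (fun g : G ↦ TangentSpace 𝓘(ℝ, F) g)}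

theorem CohomOne.IsBiinvariant.inner_adInv (hQ : IsBiinvariant Q) (g : G)
    (X Y : GroupLieAlgebra 𝓘(ℝ, F) G) : Q.inner 1 (adInv g X) (adInv g Y) = Q.inner 1 X Y := by
  have h1 : MDifferentiableAt 𝓘(ℝ, F) 𝓘(ℝ, F) (fun h : G ↦ g⁻¹ * h) 1 :=
    contMDiff_mul_left.contMDiffAt.mdifferentiableAt (n := ∞) (by simp)
  have h2 : MDifferentiableAt 𝓘(ℝ, F) 𝓘(ℝ, F) (fun h : G ↦ h * g) (g⁻¹ * 1) :=
    contMDiff_mul_right.contMDiffAt.mdifferentiableAt (n := ∞) (by simp)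
  have h3 (X : GroupLieAlgebra 𝓘(ℝ, F) G) := mfderiv_comp_apply (1 : G) h2 h1 X
  have h4 := hQ.right g (g⁻¹ * 1) (mfderiv 𝓘(ℝ, F) 𝓘(ℝ, F) (fun h : G ↦ g⁻¹ * h) 1 X)
    (mfderiv 𝓘(ℝ, F) 𝓘(ℝ, F) (fun h : G ↦ g⁻¹ * h) 1 Y)
  rw [hQ.left g⁻¹ 1 X Y] at h4
  have (y : G) (hy : 1 = y) (v w : F) :
    Q.inner (1 : G) v w = Q.inner y v w := by subst hy; rfl
  refine (this (g⁻¹ * 1 * g) (by simp) _ _).trans (Eq.trans ?_ h4)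
  exact congrArg₂ (fun v w ↦ Q.inner (g⁻¹ * 1 * g) v w) (h3 X) (h3 Y)

/-- `ad W` is skew for a biinvariant metric: differentiate the invariance of the metric under
`Ad(g⁻¹)` at the identity. -/
theorem CohomOne.IsBiinvariant.inner_lie [FiniteDimensional ℝ F] (hQ : IsBiinvariant Q)
    (W X Y : GroupLieAlgebra 𝓘(ℝ, F) G) : Q.inner 1 ⁅W, X⁆ Y = - Q.inner 1 X ⁅W, Y⁆ := by
  let β : GroupLieAlgebra 𝓘(ℝ, F) G →ₗ[ℝ] GroupLieAlgebra 𝓘(ℝ, F) G →ₗ[ℝ] ℝ :=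
    LinearMap.mk₂ ℝ (fun X Y ↦ Q.inner 1 X Y) (by simp) (by simp) (by simp) (by simp)
  have h := mvfderiv_bilin_adInv W X Y β
  have h1 : (fun g : G ↦ β (adInv g X) (adInv g Y)) = fun _ ↦ β X Y := by
    funext g
    exact hQ.inner_adInv g X Y
  rw [h1] at h
  have h2 : (0 : ℝ) = - Q.inner 1 ⁅W, X⁆ Y - Q.inner 1 X ⁅W, Y⁆ := by
    refine Eq.trans ?_ h
    simp [mvfderiv_const]
  linarith

end Biinvariant

/-! ### Action fields of isometric actions are Killing fields -/

section Killing

variable {F : Type*} [NormedAddCommGroup F] [NormedSpace ℝ F] [FiniteDimensional ℝ F]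
  {G : Type*} [TopologicalSpace G] [ChartedSpace F G] [Group G] [LieGroup 𝓘(ℝ, F) ∞ G]
  {E : Type*} [NormedAddCommGroup E] [NormedSpace ℝ E]
  {M : Type*} [TopologicalSpace M] [ChartedSpace E M] [IsManifold 𝓘(ℝ, E) ∞ M]
  [RiemannianBundle (fun x : M ↦ TangentSpace 𝓘(ℝ, E) x)]
  [IsContMDiffRiemannianBundle 𝓘(ℝ, E) ∞ E (fun x : M ↦ TangentSpace 𝓘(ℝ, E) x)]
  [MulAction G M] [ContMDiffSMul 𝓘(ℝ, F) 𝓘(ℝ, E) ∞ G M]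

/-- The derivative of `⟨X*, Y*⟩` in the direction of `W*`. Since the action is isometric,
`⟨X*, Y*⟩` at `g • p` is `⟨(Ad(g⁻¹) X)*, (Ad(g⁻¹) Y)*⟩` at `p`. -/
theorem mvfderiv_inner_actionField (hM : IsCohomogeneityOneAction F G E M)
    (p : M) (W X Y : GroupLieAlgebra 𝓘(ℝ, F) G) :
    mvfderiv 𝓘(ℝ, E) (fun x ↦ inner ℝ (actionField (E := E) x X) (actionField x Y)) p
        (actionField p W) =
      - inner ℝ (actionField (E := E) p ⁅W, X⁆) (actionField p Y)
        - inner ℝ (actionField (E := E) p X) (actionField p ⁅W, Y⁆) := by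
  let β : GroupLieAlgebra 𝓘(ℝ, F) G →ₗ[ℝ] GroupLieAlgebra 𝓘(ℝ, F) G →ₗ[ℝ] ℝ :=
    LinearMap.mk₂ ℝ (fun X Y ↦ inner ℝ (actionField (E := E) p X) (actionField p Y))
      (by simp [inner_add_left]) (by simp [inner_smul_left])
      (by simp [inner_add_right]) (by simp [inner_smul_right])
  have h := mvfderiv_bilin_adInv W X Y β
  refine Eq.trans ?_ h
  have h1 : (fun g : G ↦ β (adInv g X) (adInv g Y)) =
      (fun x ↦ inner ℝ (actionField (E := E) x X) (actionField x Y)) ∘ fun g : G ↦ g • p := by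
    funext g
    simp only [Function.comp_apply, actionField_smul, hM.isometric]
    rfl
  rw [h1]
  exact (mfderiv_comp_apply_of_eq (1 : G) (mdifferentiableAt_inner (E := E)
      (mdifferentiableAt_actionField (E := E) X p) (mdifferentiableAt_actionField (E := E) Y p))
    (mdifferentiableAt_orbitMap p 1) (one_smul G p) W).symm

variable [FiniteDimensional ℝ E]

/-- Action fields of isometric actions are Killing fields. -/
theorem inner_leviCivita_actionField_self (hM : IsCohomogeneityOneAction F G E M)
    (p : M) (W Z : GroupLieAlgebra 𝓘(ℝ, F) G) :
    inner ℝ (leviCivita E M (fun x ↦ actionField x Z) p (actionField p W)) (actionField p W) =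
      0 := by
  have : LieGroup 𝓘(ℝ, F) (minSmoothness ℝ 3) G := by
    rw [minSmoothness_of_isRCLikeNormedField]; infer_instance
  have := FiniteDimensional.complete ℝ F
  have := FiniteDimensional.complete ℝ E
  have hZ := mdifferentiableAt_actionField (E := E) Z p
  have hW := mdifferentiableAt_actionField (E := E) W p
  have h1 := mvfderiv_inner_leviCivita hZ hW hW
  have h2 := (CovariantDerivative.torsion_eq_zero_iff _).1
    (torsion_leviCivita (E := E) (M := M)) hW hZ
  rw [mlieBracket_actionField] at h2
  rw [mvfderiv_inner_actionField hM, real_inner_comm (actionField p ⁅Z, W⁆),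
    real_inner_comm (leviCivita E M (fun x ↦ actionField x W) p (actionField p Z))] at h1
  have h3 := congrArg (fun v ↦ inner ℝ v (actionField (E := E) p W)) h2
  simp only [inner_sub_left, inner_neg_left] at h3
  rw [← lie_skew W Z] at h3
  simp only [map_neg, inner_neg_left] at h3
  linarith

/-- `⟨∇_{X*} X*, Y*⟩ = ⟨[Y, X]*, X*⟩` for an isometric action. -/
theorem inner_leviCivita_actionField (hM : IsCohomogeneityOneAction F G E M)
    (p : M) (X Y : GroupLieAlgebra 𝓘(ℝ, F) G) :
    inner ℝ (leviCivita E M (fun x ↦ actionField x X) p (actionField p X)) (actionField p Y) =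
      inner ℝ (actionField (E := E) p ⁅Y, X⁆) (actionField p X) := by
  have : LieGroup 𝓘(ℝ, F) (minSmoothness ℝ 3) G := by
    rw [minSmoothness_of_isRCLikeNormedField]; infer_instance
  have := FiniteDimensional.complete ℝ F
  have hX := mdifferentiableAt_actionField (E := E) X p
  have hY := mdifferentiableAt_actionField (E := E) Y p
  have h1 := mvfderiv_inner_leviCivita hX hX hY
  rw [mvfderiv_inner_actionField hM, lie_self, map_zero, inner_zero_left,
    real_inner_comm (leviCivita E M (fun x ↦ actionField x Y) p (actionField p X)),
    inner_leviCivita_actionField_self hM, ← lie_skew, map_neg, inner_neg_right,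
    real_inner_comm] at h1
  linarith

end Killing

/-! ### The isotropy algebra and its orthogonal complement -/

section Isotropy

variable {F : Type*} [NormedAddCommGroup F] [NormedSpace ℝ F] [FiniteDimensional ℝ F]
  {G : Type*} [TopologicalSpace G] [ChartedSpace F G] [Group G] [LieGroup 𝓘(ℝ, F) ∞ G]
  {E : Type*} [NormedAddCommGroup E] [NormedSpace ℝ E]
  {M : Type*} [TopologicalSpace M] [ChartedSpace E M] [IsManifold 𝓘(ℝ, E) ∞ M]
  [MulAction G M] [ContMDiffSMul 𝓘(ℝ, F) 𝓘(ℝ, E) ∞ G M]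

/-- The Lie algebra of the isotropy group of `p` is the kernel of `X ↦ X*(p)`. If `X*(p) = 0`, then
an integral curve `c` of the left-invariant field of `X` satisfies
`(c • p)' = d(c •) (X*(p)) = 0`, so that it runs in the isotropy group. -/
theorem mem_subgroupLieAlgebra_stabilizer_iff (p : M) (X : GroupLieAlgebra 𝓘(ℝ, F) G) :
    X ∈ subgroupLieAlgebra (F := F) (MulAction.stabilizer G p) ↔
      (actionField p X : TangentSpace 𝓘(ℝ, E) p) = 0 := by
  classical
  have := FiniteDimensional.complete ℝ F
  have : LieGroup 𝓘(ℝ, F) (minSmoothness ℝ 3) G := by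
    rw [minSmoothness_of_isRCLikeNormedField]; infer_instance
  constructor
  · rintro ⟨c, hc0, hc, hcd, h⟩
    have h1 := congrArg (fun v : TangentBundle 𝓘(ℝ, F) G ↦
      (mfderiv 𝓘(ℝ, F) 𝓘(ℝ, E) (fun g : G ↦ g • p) v.1 v.2 : E)) h
    refine h1.symm.trans ?_
    have h2 : (fun g : G ↦ g • p) ∘ c = fun _ ↦ p := funext hc
    have h3 := mfderiv_comp_apply 0 (mdifferentiableAt_orbitMap (E := E) p (c 0)) hcd 1
    rw [h2, mfderiv_const] at h3
    exact h3.symm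
  · intro hX
    have hv : ContMDiffAt 𝓘(ℝ, F) 𝓘(ℝ, F).tangent 1
        (fun g : G ↦ (mulInvariantVectorField X g : TangentBundle 𝓘(ℝ, F) G)) 1 :=
      (contMDiff_mulInvariantVectorField X).contMDiffAt.of_le
        (by rw [minSmoothness_of_isRCLikeNormedField]; norm_num)
    obtain ⟨c, hc0, hc⟩ := exists_isMIntegralCurveAt_of_contMDiffAt_boundaryless 0 hv
    have hf : IsMIntegralCurveAt (I := 𝓘(ℝ, E)) (fun s ↦ c s • p) (fun _ ↦ 0) 0 := by
      refine hc.mono fun s hs ↦ ?_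
      have h1 := HasMFDerivAt.comp s (mdifferentiableAt_orbitMap (E := E) p (c s)).hasMFDerivAt hs
      refine h1.congr_mfderiv ?_
      ext
      have h2 := mfderiv_smul_actionField (E := E) p (c s) X
      rw [hX, map_zero] at h2
      exact (congrArg (mfderiv 𝓘(ℝ, F) 𝓘(ℝ, E) (fun g : G ↦ g • p) (c s))
        (one_smul ℝ (mulInvariantVectorField X (c s)))).trans
          (h2.symm.trans (smul_zero (1 : ℝ)).symm)
    have hconst : IsMIntegralCurveAt (I := 𝓘(ℝ, E)) (fun _ : ℝ ↦ p) (fun _ ↦ 0) 0 := by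
      refine .of_forall fun s ↦ ?_
      refine (hasMFDerivAt_const p s).congr_mfderiv ?_
      ext
      exact (smul_zero (1 : ℝ)).symm
    have hev : ∀ᶠ s in 𝓝 (0 : ℝ), c s • p = p :=
      isMIntegralCurveAt_eventuallyEq_of_contMDiffAt_boundaryless (I := 𝓘(ℝ, E)) (t₀ := 0)
        (γ := fun s ↦ c s • p) (γ' := fun _ ↦ p)
        ((contMDiff_zeroSection ℝ (TangentSpace 𝓘(ℝ, E) : M → Type _)).contMDiffAt) hf hconst
        (by simp [hc0])
    -- `c` stays in the isotropy group only for small times, and is cut off beyond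
    let c' : ℝ → G := fun s ↦ if c s • p = p then c s else 1
    have hc' : c' =ᶠ[𝓝 0] c := hev.mono fun s hs ↦ if_pos hs
    have hc'0 : c' 0 = 1 := hc'.eq_of_nhds.trans hc0
    have hd := hc.self_of_nhds.congr_of_eventuallyEq hc'
    refine ⟨c', hc'0, fun s ↦ ?_, hd.mdifferentiableAt, ?_⟩
    · by_cases h : c s • p = p
      · simp [c', h]
      · simp [c', h]
    · have h1 : (velocity (E := F) c' 0 : F) = X := by
        refine (congrArg (fun L : ℝ →L[ℝ] F ↦ L 1) hd.mfderiv).trans ?_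
        have (y : G) (hy : y = 1) : (mulInvariantVectorField X y : F) = X := by
          subst hy; exact mulInvariantVectorField_one X
        exact (one_smul ℝ (mulInvariantVectorField X (c 0))).trans (this _ hc0)
      have (y : G) (hy : y = 1) (v : F) (hv : v = X) :
        (⟨y, v⟩ : TangentBundle 𝓘(ℝ, F) G) = ⟨1, X⟩ := by subst hy hv; rfl
      exact this _ hc'0 _ h1

variable {Q : ContMDiffRiemannianMetric 𝓘(ℝ, F) ∞ F (fun g : G ↦ TangentSpace 𝓘(ℝ, F) g)}

theorem mem_lieComplement_stabilizer_iff (p : M) (Y : GroupLieAlgebra 𝓘(ℝ, F) G) :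
    Y ∈ lieComplement Q (MulAction.stabilizer G p) ↔ ∀ X : GroupLieAlgebra 𝓘(ℝ, F) G,
      (actionField p X : TangentSpace 𝓘(ℝ, E) p) = 0 → Q.inner 1 X Y = 0 :=
  forall_congr' fun X ↦ by rw [mem_subgroupLieAlgebra_stabilizer_iff (E := E)]

theorem eq_zero_of_mem_lieComplement {p : M} {Y : GroupLieAlgebra 𝓘(ℝ, F) G}
    (hY : Y ∈ lieComplement Q (MulAction.stabilizer G p))
    (h : (actionField p Y : TangentSpace 𝓘(ℝ, E) p) = 0) : Y = 0 := by
  by_contra h0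
  exact (Q.pos 1 Y h0).ne' ((mem_lieComplement_stabilizer_iff (E := E) p Y).1 hY Y h)

/-- The isotropy algebra is the `Q`-orthogonal complement of its complement `𝔫`, so the projection to
`𝔫` changes an element only by an element of the isotropy algebra. -/
theorem actionField_lieProjection (p : M) (Y : GroupLieAlgebra 𝓘(ℝ, F) G) :
    (actionField p (lieProjection Q (lieComplement Q (MulAction.stabilizer G p)) Y :
      GroupLieAlgebra 𝓘(ℝ, F) G) : TangentSpace 𝓘(ℝ, E) p) = actionField p Y := by
  let B : LinearMap.BilinForm ℝ (GroupLieAlgebra 𝓘(ℝ, F) G) :=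
    LinearMap.mk₂ ℝ (fun X Y ↦ Q.inner 1 X Y) (by simp) (by simp) (by simp) (by simp)
  have hB (X Y) : B X Y = Q.inner 1 X Y := rfl
  have hrefl : B.IsRefl := fun X Y h ↦ by rw [hB, Q.symm]; exact h
  have hpos : ∀ X, B X X = 0 → X = 0 := fun X hX ↦ by
    by_contra h
    exact (Q.pos 1 X h).ne' hX
  have hnd : B.Nondegenerate := ⟨fun X hX ↦ hpos X (hX X), fun X hX ↦ hpos X (hX X)⟩
  let 𝔥 : Submodule ℝ (GroupLieAlgebra 𝓘(ℝ, F) G) :=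
    LinearMap.ker (actionField (E := E) p).toLinearMap
  have horth : B.orthogonal 𝔥 = lieComplement Q (MulAction.stabilizer G p) := by
    ext Y
    rw [LinearMap.BilinForm.mem_orthogonal_iff, mem_lieComplement_stabilizer_iff (E := E) p]
    rfl
  set Y₁ := lieProjection Q (lieComplement Q (MulAction.stabilizer G p)) Y
  have hmem : Y - (Y₁ : GroupLieAlgebra 𝓘(ℝ, F) G) ∈ B.orthogonal (B.orthogonal 𝔥) := by
    rw [horth, LinearMap.BilinForm.mem_orthogonal_iff]
    intro X hX
    change Q.inner 1 X (Y - (Y₁ : GroupLieAlgebra 𝓘(ℝ, F) G)) = 0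
    rw [Q.symm, map_sub, sub_apply]
    exact sub_eq_zero.2 (inner_lieProjection Q _ Y ⟨X, hX⟩).symm
  rw [LinearMap.BilinForm.orthogonal_orthogonal hnd hrefl] at hmem
  have h : actionField (E := E) p (Y - (Y₁ : GroupLieAlgebra 𝓘(ℝ, F) G)) = 0 := hmem
  rw [map_sub, sub_eq_zero] at h
  exact h.symm

/-- A skew map is conjugate, through the form, to the negative of its transpose. -/
theorem trace_eq_zero_of_skew {V : Type*} [AddCommGroup V] [Module ℝ V] [FiniteDimensional ℝ V]
    {B : LinearMap.BilinForm ℝ V} (hB : B.Nondegenerate) {T : V →ₗ[ℝ] V}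
    (hT : ∀ x y, B (T x) y = - B x (T y)) : LinearMap.trace ℝ V T = 0 := by
  have h : (B.toDual hB).conj T = - Module.Dual.transpose (R := ℝ) T := by
    ext φ y
    obtain ⟨x, rfl⟩ := (B.toDual hB).surjective φ
    simp [LinearEquiv.conj_apply, LinearMap.BilinForm.toDual_def, hT, Module.Dual.transpose_apply]
  have h1 := LinearMap.trace_conj' T (B.toDual hB)
  have h2 : LinearMap.trace ℝ (Dual ℝ V) (- Module.Dual.transpose (R := ℝ) T) =
      - LinearMap.trace ℝ V T :=
    (map_neg (LinearMap.trace ℝ (Dual ℝ V)) _).trans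
      (congrArg Neg.neg (LinearMap.trace_transpose' T))
  rw [h, h2] at h1
  linarith

variable [RiemannianBundle (fun x : M ↦ TangentSpace 𝓘(ℝ, E) x)]

/-- The compression of `ad Y` to `𝔫` is `Q`-skew, so its trace vanishes. -/
theorem sum_inner_actionField_lie (hQ : IsBiinvariant Q) (p : M) {ι : Type*} [Fintype ι]
    {X : ι → GroupLieAlgebra 𝓘(ℝ, F) G}
    (hX : ∀ i, X i ∈ lieComplement Q (MulAction.stabilizer G p))
    (hXorth : Orthonormal ℝ (fun i ↦ (actionField p (X i) : TangentSpace 𝓘(ℝ, E) p)))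
    (hXspan : Submodule.span ℝ
      (Set.range fun i ↦ (actionField p (X i) : TangentSpace 𝓘(ℝ, E) p)) = orbitTangent F G p)
    (Y : GroupLieAlgebra 𝓘(ℝ, F) G) :
    ∑ i, inner ℝ (actionField (E := E) p ⁅Y, X i⁆) (actionField p (X i)) = 0 := by
  classical
  have := FiniteDimensional.complete ℝ F
  have : LieGroup 𝓘(ℝ, F) (minSmoothness ℝ 3) G := by
    rw [minSmoothness_of_isRCLikeNormedField]; infer_instance
  set n := lieComplement Q (MulAction.stabilizer G p)
  let a : n →ₗ[ℝ] TangentSpace 𝓘(ℝ, E) p := (actionField (E := E) p).toLinearMap ∘ₗ n.subtype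
  have ha : Function.Injective a := by
    rw [← LinearMap.ker_eq_bot, LinearMap.ker_eq_bot']
    exact fun Y hY ↦ Subtype.ext (eq_zero_of_mem_lieComplement (E := E) Y.2 hY)
  let x : ι → n := fun i ↦ ⟨X i, hX i⟩
  have hli : LinearIndependent ℝ x := LinearIndependent.of_comp a hXorth.linearIndependent
  have hsp : ⊤ ≤ Submodule.span ℝ (Set.range x) := by
    intro Y _
    have h1 : a Y ∈ orbitTangent F G (E := E) p := ⟨Y, rfl⟩
    rw [← hXspan] at h1
    have h2 : (Set.range fun i ↦ (actionField p (X i) : TangentSpace 𝓘(ℝ, E) p)) =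
        a '' Set.range x := by
      rw [← Set.range_comp]; rfl
    rw [h2, Submodule.span_image] at h1
    obtain ⟨Y', hY', h3⟩ := h1
    rwa [← ha h3]
  -- `X ↦ X*(p)` is injective on `𝔫`, so the `X i` form a basis of `𝔫`; in this basis the diagonal
  -- entries of the compression of `ad Y` are the terms of the sum
  let b : Basis ι ℝ n := Basis.mk hli hsp
  have hb (i) : (b i : GroupLieAlgebra 𝓘(ℝ, F) G) = X i := by simp [b, x]
  let T : n →ₗ[ℝ] n := lieProjection Q n ∘ₗ
    (LieAlgebra.ad ℝ (GroupLieAlgebra 𝓘(ℝ, F) G) Y) ∘ₗ n.subtype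
  have hTa (Z : n) : a (T Z) = actionField (E := E) p ⁅Y, (Z : GroupLieAlgebra 𝓘(ℝ, F) G)⁆ :=
    actionField_lieProjection p _
  have hT : LinearMap.trace ℝ n T = 0 := by
    refine trace_eq_zero_of_skew (nondegenerate_restrictForm Q n) fun Z W ↦ ?_
    refine (inner_lieProjection Q n _ W).trans ?_
    refine (hQ.inner_lie Y Z W).trans ?_
    rw [Q.symm]
    refine congrArg Neg.neg ((inner_lieProjection Q n _ Z).symm.trans ?_)
    rw [Q.symm]
    rfl
  rw [LinearMap.trace_eq_matrix_trace ℝ b, Matrix.trace] at hT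
  rw [← hT]
  refine Finset.sum_congr rfl fun i _ ↦ ?_
  rw [Matrix.diag_apply, LinearMap.toMatrix_apply, ← hb i, ← hTa (b i)]
  conv_lhs => rw [← b.sum_repr (T (b i)), map_sum, sum_inner]
  have h (j) : inner ℝ (a (b j)) (actionField (E := E) p (b i : GroupLieAlgebra 𝓘(ℝ, F) G)) =
      if j = i then (1 : ℝ) else 0 := by
    have := orthonormal_iff_ite.1 hXorth j i
    rw [← this, ← hb i, ← hb j]
    rfl
  simp [inner_smul_left, h]

end Isotropy

/-! ### The metric endomorphism -/

section MetricEndomorphism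

variable {F : Type*} [NormedAddCommGroup F] [NormedSpace ℝ F] [FiniteDimensional ℝ F]
  {G : Type*} [TopologicalSpace G] [ChartedSpace F G] [Group G] [LieGroup 𝓘(ℝ, F) ∞ G]
  {E : Type*} [NormedAddCommGroup E] [NormedSpace ℝ E]
  {M : Type*} [TopologicalSpace M] [ChartedSpace E M] [IsManifold 𝓘(ℝ, E) ∞ M]
  [MulAction G M] [ContMDiffSMul 𝓘(ℝ, F) 𝓘(ℝ, E) ∞ G M]
  [RiemannianBundle (fun x : M ↦ TangentSpace 𝓘(ℝ, E) x)]
  {Q : ContMDiffRiemannianMetric 𝓘(ℝ, F) ∞ F (fun g : G ↦ TangentSpace 𝓘(ℝ, F) g)}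

/-- The defining equation of `P` holds for all `Y` in the Lie algebra, not only in `𝔫`. -/
theorem inner_metricEndomorphism_left (p : M)
    (W : lieComplement Q (MulAction.stabilizer G p)) (Y : GroupLieAlgebra 𝓘(ℝ, F) G) :
    Q.inner 1 (metricEndomorphism E Q (lieComplement Q (MulAction.stabilizer G p)) p W :
        GroupLieAlgebra 𝓘(ℝ, F) G) Y =
      inner ℝ (actionField (E := E) p (W : GroupLieAlgebra 𝓘(ℝ, F) G)) (actionField p Y) := by
  rw [Q.symm, ← inner_lieProjection, inner_metricEndomorphism, actionField_lieProjection,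
    real_inner_comm]

theorem inner_metricEndomorphism_lieProjection (p : M) (W Y : GroupLieAlgebra 𝓘(ℝ, F) G) :
    Q.inner 1 (metricEndomorphism E Q (lieComplement Q (MulAction.stabilizer G p)) p
        (lieProjection Q _ W) : GroupLieAlgebra 𝓘(ℝ, F) G) Y =
      inner ℝ (actionField (E := E) p W) (actionField p Y) := by
  rw [inner_metricEndomorphism_left, actionField_lieProjection]

theorem bijective_metricEndomorphism (p : M) : Function.Bijective
    (metricEndomorphism E Q (lieComplement Q (MulAction.stabilizer G p)) p) := by
  have hinj : Function.Injective
      (metricEndomorphism E Q (lieComplement Q (MulAction.stabilizer G p)) p) := by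
    rw [← LinearMap.ker_eq_bot, LinearMap.ker_eq_bot']
    intro Y hY
    refine Subtype.ext (eq_zero_of_mem_lieComplement (E := E) Y.2 ?_)
    rw [← inner_self_eq_zero (𝕜 := ℝ), ← inner_metricEndomorphism_left (Q := Q), hY]
    simp
  exact ⟨hinj, LinearMap.injective_iff_surjective.1 hinj⟩

theorem inner_lie_metricEndomorphism (hQ : IsBiinvariant Q) (p : M)
    (W Z : GroupLieAlgebra 𝓘(ℝ, F) G) :
    Q.inner 1 ⁅W, (metricEndomorphism E Q (lieComplement Q (MulAction.stabilizer G p)) p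
        (lieProjection Q _ W) : GroupLieAlgebra 𝓘(ℝ, F) G)⁆ Z =
      - inner ℝ (actionField (E := E) p W) (actionField p ⁅W, Z⁆) := by
  rw [hQ.inner_lie, inner_metricEndomorphism_lieProjection]

variable [IsContMDiffRiemannianBundle 𝓘(ℝ, E) ∞ E (fun x : M ↦ TangentSpace 𝓘(ℝ, E) x)]

/-- If `Z*(p) = 0`, then `0 = Z*⟨W*, W*⟩ = 2 ⟨W*, [W, Z]*⟩` at `p`. -/
theorem lie_metricEndomorphism_mem_lieComplement (hM : IsCohomogeneityOneAction F G E M)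
    (hQ : IsBiinvariant Q) (p : M) (W : GroupLieAlgebra 𝓘(ℝ, F) G) :
    ⁅W, (metricEndomorphism E Q (lieComplement Q (MulAction.stabilizer G p)) p
        (lieProjection Q _ W) : GroupLieAlgebra 𝓘(ℝ, F) G)⁆ ∈
      lieComplement Q (MulAction.stabilizer G p) := by
  have := FiniteDimensional.complete ℝ F
  have : LieGroup 𝓘(ℝ, F) (minSmoothness ℝ 3) G := by
    rw [minSmoothness_of_isRCLikeNormedField]; infer_instance
  rw [mem_lieComplement_stabilizer_iff (E := E)]
  intro Z hZ
  rw [Q.symm, inner_lie_metricEndomorphism hQ]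
  have h := mvfderiv_inner_actionField hM p Z W W
  rw [hZ, map_zero, real_inner_comm (actionField p ⁅Z, W⁆), ← lie_skew Z W, map_neg,
    inner_neg_left, real_inner_comm] at h
  linarith

end MetricEndomorphism

/-! ### Smoothness of equivariant maps -/

section Submersion

variable {E : Type*} [NormedAddCommGroup E] [NormedSpace ℝ E] [FiniteDimensional ℝ E]
  {M : Type*} [TopologicalSpace M] [ChartedSpace E M] [IsManifold 𝓘(ℝ, E) ∞ M]
  {E' : Type*} [NormedAddCommGroup E'] [NormedSpace ℝ E']
  {N : Type*} [TopologicalSpace N] [ChartedSpace E' N]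
  {V : Type*} [NormedAddCommGroup V] [NormedSpace ℝ V]

/-- Smoothness can be checked after composition with a submersion `g`: restricting `g` to an affine
complement of the kernel of its differential gives a local diffeomorphism. -/
theorem ContMDiffAt.of_comp_submersion {g : V → M} {v : V} {ψ : M → N}
    (hg : ContMDiffAt 𝓘(ℝ, V) 𝓘(ℝ, E) ∞ g v)
    (hsurj : Function.Surjective (mfderiv 𝓘(ℝ, V) 𝓘(ℝ, E) g v))
    (hψ : ContMDiffAt 𝓘(ℝ, V) 𝓘(ℝ, E') ∞ (ψ ∘ g) v) :
    ContMDiffAt 𝓘(ℝ, E) 𝓘(ℝ, E') ∞ ψ (g v) := by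
  have := FiniteDimensional.complete ℝ E
  set φ := extChartAt 𝓘(ℝ, E) (g v)
  have hφ : ContMDiffAt 𝓘(ℝ, E) 𝓘(ℝ, E) ∞ φ (g v) := contMDiffAt_extChartAt
  let f : V → E := φ ∘ g
  have hf : ContDiffAt ℝ ∞ f v := (hφ.comp v hg).contDiffAt
  have hfs : Function.Surjective (fderiv ℝ f v) := by
    have h1 : fderiv ℝ f v = (mfderiv 𝓘(ℝ, E) 𝓘(ℝ, E) φ (g v)).comp
        (mfderiv 𝓘(ℝ, V) 𝓘(ℝ, E) g v) := by
      rw [← mfderiv_eq_fderiv]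
      exact mfderiv_comp v (hφ.mdifferentiableAt (by simp)) (hg.mdifferentiableAt (by simp))
    rw [h1]
    exact (isInvertible_mfderiv_extChartAt (mem_extChartAt_source (g v))).bijective.surjective.comp
      hsurj
  obtain ⟨L, hL⟩ := (fderiv ℝ f v).toLinearMap.exists_rightInverse_of_surjective
    (LinearMap.range_eq_top.2 hfs)
  let k : E → V := fun u ↦ v + L.toContinuousLinearMap u
  have hk0 : k 0 = v := by simp [k]
  have hk : ContDiffAt ℝ ∞ k 0 :=
    contDiffAt_const.add L.toContinuousLinearMap.contDiff.contDiffAt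
  have hkd : HasFDerivAt k L.toContinuousLinearMap 0 :=
    L.toContinuousLinearMap.hasFDerivAt.const_add v
  have hh : ContDiffAt ℝ ∞ (f ∘ k) 0 := (hk0.symm ▸ hf).comp 0 hk
  have hfd : HasFDerivAt f (fderiv ℝ f v) (k 0) := by
    rw [hk0]; exact (hf.differentiableAt (by simp)).hasFDerivAt
  have hhd : HasFDerivAt (f ∘ k) ((ContinuousLinearEquiv.refl ℝ E : E ≃L[ℝ] E) : E →L[ℝ] E) 0 := by
    refine (hfd.comp 0 hkd).congr_fderiv ?_
    ext u
    exact LinearMap.congr_fun hL u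
  have hfk0 : (f ∘ k) 0 = φ (g v) := by simp [f, hk0]
  have hn : (∞ : WithTop ℕ∞) ≠ 0 := by simp
  set σ := hh.localInverse hhd hn
  have hσ : ContDiffAt ℝ ∞ σ (φ (g v)) := by
    have := hh.to_localInverse hhd hn
    rwa [hfk0] at this
  have hσ0 : σ (φ (g v)) = 0 := by
    have := (hh.hasStrictFDerivAt' hhd hn).localInverse_apply_image
    rwa [hfk0] at this
  have hinv : ∀ᶠ z in 𝓝 (φ (g v)), f (k (σ z)) = z := by
    have := (hh.hasStrictFDerivAt' hhd hn).eventually_right_inverse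
    rwa [hfk0] at this
  let s : M → V := fun y ↦ k (σ (φ y))
  have hs0 : s (g v) = v := by simp only [s, hσ0, hk0]
  have hs : ContMDiffAt 𝓘(ℝ, E) 𝓘(ℝ, V) ∞ s (g v) := by
    refine ContMDiffAt.comp (g v) (I' := 𝓘(ℝ, E)) (g := k ∘ σ) ?_ hφ
    exact (ContDiffAt.comp _ (by rw [hσ0]; exact hk) hσ).contMDiffAt
  have hgs : ∀ᶠ y in 𝓝 (g v), g (s y) = y := by
    have h1 : ∀ᶠ y in 𝓝 (g v), y ∈ φ.source := extChartAt_source_mem_nhds (g v)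
    have h2 : ∀ᶠ y in 𝓝 (g v), g (s y) ∈ φ.source := by
      have : ContinuousAt (g ∘ s) (g v) :=
        ContinuousAt.comp (by rw [hs0]; exact hg.continuousAt) hs.continuousAt
      refine this.eventually ?_
      simp only [Function.comp_apply, hs0]
      exact extChartAt_source_mem_nhds (g v)
    filter_upwards [h1, h2, hφ.continuousAt.eventually hinv] with y hy1 hy2 hy3
    exact φ.injOn hy2 hy1 hy3
  refine (ContMDiffAt.comp (g v) (by rw [hs0]; exact hψ) hs).congr_of_eventuallyEq ?_
  filter_upwards [hgs] with y hy
  simp [hy]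

end Submersion

section EquivariantMap

variable {F : Type*} [NormedAddCommGroup F] [NormedSpace ℝ F]
  {G : Type*} [TopologicalSpace G] [ChartedSpace F G] [Group G] [LieGroup 𝓘(ℝ, F) ∞ G]
  {F' : Type*} [NormedAddCommGroup F'] [NormedSpace ℝ F']
  {K : Type*} [TopologicalSpace K] [ChartedSpace F' K] [Group K]
  {E : Type*} [NormedAddCommGroup E] [NormedSpace ℝ E] [FiniteDimensional ℝ E]
  {M : Type*} [TopologicalSpace M] [ChartedSpace E M] [IsManifold 𝓘(ℝ, E) ∞ M]
  [MulAction G M] [ContMDiffSMul 𝓘(ℝ, F) 𝓘(ℝ, E) ∞ G M]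
  {E' : Type*} [NormedAddCommGroup E'] [NormedSpace ℝ E']
  {N : Type*} [TopologicalSpace N] [ChartedSpace E' N]
  [MulAction K N] [ContMDiffSMul 𝓘(ℝ, F') 𝓘(ℝ, E') ∞ K N]

/-- If `γ` is transversal to the orbit of `γ t`, then `(g, s) ↦ g • γ s` is a submersion near
`(1, t)`, so that an equivariant map is smooth near `γ t`. -/
theorem contMDiffAt_of_equivariant {γ : ℝ → M} {γ' : ℝ → N} {A : G →* K} {r : ℝ → ℝ}
    {ψ : M → N} {J : Set ℝ} {t : ℝ}
    (hγ : ContMDiff 𝓘(ℝ, ℝ) 𝓘(ℝ, E) ∞ γ) (hγ' : ContMDiff 𝓘(ℝ, ℝ) 𝓘(ℝ, E') ∞ γ')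
    (hA : ContMDiff 𝓘(ℝ, F) 𝓘(ℝ, F') ∞ A) (hJ : J ∈ 𝓝 t) (hr : ContDiffOn ℝ ∞ r J)
    (hψ : ∀ g : G, ∀ s ∈ J, ψ (g • γ s) = A g • γ' (r s))
    (htrans : ∀ v : TangentSpace 𝓘(ℝ, E) (γ t), ∃ (X : GroupLieAlgebra 𝓘(ℝ, F) G) (c : ℝ),
      v = actionField (γ t) X + c • velocity γ t) :
    ContMDiffAt 𝓘(ℝ, E) 𝓘(ℝ, E') ∞ ψ (γ t) := by
  set e := extChartAt 𝓘(ℝ, F) (1 : G)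
  have he : ContMDiffAt 𝓘(ℝ, F) 𝓘(ℝ, F) ∞ e.symm (e 1) :=
    (contMDiffOn_extChartAt_symm (1 : G)).contMDiffAt (extChartAt_target_mem_nhds 1)
  have he1 : e.symm (e 1) = 1 := extChartAt_to_inv 1
  let h : F × ℝ → M := fun z ↦ e.symm z.1 • γ z.2
  have h1 : ContMDiffAt 𝓘(ℝ, F × ℝ) 𝓘(ℝ, F) ∞ (fun z : F × ℝ ↦ e.symm z.1) (e 1, t) :=
    ContMDiffAt.comp (e 1, t) (I' := 𝓘(ℝ, F)) (f := Prod.fst) he contDiff_fst.contMDiff.contMDiffAt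
  have h2 : ContMDiffAt 𝓘(ℝ, F × ℝ) 𝓘(ℝ, ℝ) ∞ (fun z : F × ℝ ↦ z.2) (e 1, t) :=
    contDiff_snd.contMDiff.contMDiffAt
  have hh : ContMDiffAt 𝓘(ℝ, F × ℝ) 𝓘(ℝ, E) ∞ h (e 1, t) :=
    h1.smul (hγ.contMDiffAt.comp _ h2)
  have hh0 : h (e 1, t) = γ t := by simp [h, he1]
  rw [← hh0]
  refine ContMDiffAt.of_comp_submersion hh ?_ ?_
  · have hd := hh.mdifferentiableAt (by simp)
    let k₁ : G → F × ℝ := fun g ↦ (e g, t)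
    let k₂ : ℝ → F × ℝ := fun s ↦ (e 1, s)
    have hk₁ : MDifferentiableAt 𝓘(ℝ, F) 𝓘(ℝ, F × ℝ) k₁ 1 :=
      ((contMDiffAt_extChartAt (n := ∞)).prodMk_space contMDiffAt_const).mdifferentiableAt (by simp)
    have hk₂ : MDifferentiableAt 𝓘(ℝ, ℝ) 𝓘(ℝ, F × ℝ) k₂ t :=
      (differentiableAt_const _ |>.prodMk differentiableAt_id).mdifferentiableAt
    have h3 : h ∘ k₁ =ᶠ[𝓝 1] fun g ↦ g • γ t := by
      filter_upwards [extChartAt_source_mem_nhds (I := 𝓘(ℝ, F)) (1 : G)] with g hg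
      simp only [Function.comp_apply, h, k₁]
      rw [e.left_inv hg]
    have h4 : h ∘ k₂ = γ := by
      funext s
      simp [h, k₂, he1]
    intro v
    obtain ⟨X, c, hXc⟩ := htrans v
    refine ⟨mfderiv 𝓘(ℝ, F) 𝓘(ℝ, F × ℝ) k₁ 1 X + c • mfderiv 𝓘(ℝ, ℝ) 𝓘(ℝ, F × ℝ) k₂ t (1 : ℝ), ?_⟩
    have h5 := mfderiv_comp_apply (1 : G) (g := h) hd hk₁ X
    have h6 := mfderiv_comp_apply t (g := h) hd hk₂ (1 : ℝ)
    rw [h3.mfderiv_eq] at h5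
    rw [h4] at h6
    refine (map_add (mfderiv 𝓘(ℝ, F × ℝ) 𝓘(ℝ, E) h (e 1, t)) _ _).trans ?_
    refine Eq.trans ?_ hXc.symm
    refine congrArg₂ (fun a b : E ↦ a + b) h5.symm ?_
    refine (map_smul (mfderiv 𝓘(ℝ, F × ℝ) 𝓘(ℝ, E) h (e 1, t)) c _).trans ?_
    exact congrArg (fun a : E ↦ c • a) h6.symm
  · have hrt : ContMDiffAt 𝓘(ℝ, ℝ) 𝓘(ℝ, ℝ) ∞ r t := (hr.contDiffAt hJ).contMDiffAt
    have h3 : ContMDiffAt 𝓘(ℝ, F × ℝ) 𝓘(ℝ, E') ∞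
        (fun z : F × ℝ ↦ A (e.symm z.1) • γ' (r z.2)) (e 1, t) :=
      (hA.contMDiffAt.comp _ h1).smul (hγ'.contMDiffAt.comp _
        (ContMDiffAt.comp (e 1, t) (f := Prod.snd) hrt h2))
    refine h3.congr_of_eventuallyEq ?_
    filter_upwards [continuousAt_snd.eventually hJ] with z hz
    exact hψ _ _ hz

end EquivariantMap

/-! ### The second fundamental form paired with a vector field -/

section SecondFundamentalForm

/-- The trace of a bilinear form does not depend on the orthonormal basis. -/
theorem OrthonormalBasis.sum_bilin_eq {V : Type*} [NormedAddCommGroup V] [InnerProductSpace ℝ V]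
    {ι κ : Type*} [Fintype ι] [Fintype κ] (β : V →ₗ[ℝ] V →ₗ[ℝ] ℝ) (e : OrthonormalBasis ι ℝ V)
    (f : OrthonormalBasis κ ℝ V) : ∑ i, β (e i) (e i) = ∑ j, β (f j) (f j) := by
  classical
  have h (i) : β (e i) (e i) = ∑ j, ∑ k, inner ℝ (f j) (e i) * inner ℝ (e i) (f k) *
      β (f j) (f k) := by
    conv_lhs => rw [← f.sum_repr' (e i)]
    simp only [map_sum, map_smul, LinearMap.sum_apply, LinearMap.smul_apply, smul_eq_mul,
      Finset.mul_sum]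
    rw [Finset.sum_comm]
    refine Finset.sum_congr rfl fun j _ ↦ Finset.sum_congr rfl fun k _ ↦ ?_
    rw [real_inner_comm (e i) (f k)]
    ring
  simp only [h]
  rw [Finset.sum_comm]
  refine Finset.sum_congr rfl fun j _ ↦ ?_
  rw [Finset.sum_comm]
  simp only [← Finset.sum_mul, e.sum_inner_mul_inner, orthonormal_iff_ite.1 f.orthonormal]
  simp

theorem mdifferentiableAt_inner_mfderiv
    {E : Type*} [NormedAddCommGroup E] [NormedSpace ℝ E]
    {M : Type*} [TopologicalSpace M] [ChartedSpace E M] [IsManifold 𝓘(ℝ, E) ∞ M]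
    {E' : Type*} [NormedAddCommGroup E'] [NormedSpace ℝ E']
    {N : Type*} [TopologicalSpace N] [ChartedSpace E' N] [IsManifold 𝓘(ℝ, E') ∞ N]
    [RiemannianBundle (fun x : N ↦ TangentSpace 𝓘(ℝ, E') x)]
    [IsContMDiffRiemannianBundle 𝓘(ℝ, E') ∞ E' (fun x : N ↦ TangentSpace 𝓘(ℝ, E') x)]
    {φ : M → N} {Z : Π y : N, TangentSpace 𝓘(ℝ, E') y} {p : M}
    (hφ : ContMDiffAt 𝓘(ℝ, E) 𝓘(ℝ, E') 2 φ p)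
    (hZ : MDiffAt (T% Z) (φ p)) {W : Π x : M, TangentSpace 𝓘(ℝ, E) x} (hW : MDiffAt (T% W) p) :
    MDiffAt (fun x ↦ inner ℝ (Z (φ x)) (mfderiv 𝓘(ℝ, E) 𝓘(ℝ, E') φ x (W x))) p :=
  MDifferentiableAt.inner_bundle (F := E') (E := fun y : N ↦ TangentSpace 𝓘(ℝ, E') y) (b := φ)
    (hZ.comp p (hφ.mdifferentiableAt two_ne_zero)) (MDifferentiableAt.mfderiv_section hφ hW)

variable {E : Type*} [NormedAddCommGroup E] [NormedSpace ℝ E] [FiniteDimensional ℝ E]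
  {M : Type*} [TopologicalSpace M] [ChartedSpace E M] [IsManifold 𝓘(ℝ, E) ∞ M]
  [RiemannianBundle (fun x : M ↦ TangentSpace 𝓘(ℝ, E) x)]
  [IsContMDiffRiemannianBundle 𝓘(ℝ, E) ∞ E (fun x : M ↦ TangentSpace 𝓘(ℝ, E) x)]
  {E' : Type*} [NormedAddCommGroup E'] [NormedSpace ℝ E'] [FiniteDimensional ℝ E']
  {N : Type*} [TopologicalSpace N] [ChartedSpace E' N] [IsManifold 𝓘(ℝ, E') ∞ N]
  [RiemannianBundle (fun x : N ↦ TangentSpace 𝓘(ℝ, E') x)]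
  [IsContMDiffRiemannianBundle 𝓘(ℝ, E') ∞ E' (fun x : N ↦ TangentSpace 𝓘(ℝ, E') x)]

/-- The one-form `v ↦ v ⟨Z ∘ φ, dφ W⟩ - ⟨Z, dφ(∇_v W)⟩ - ⟨∇_{dφ v} Z, dφ W⟩` at `p`, which depends
on `W` only through its value at `p` and equals `v ↦ ⟨Z, ∇dφ(v, W)⟩`. -/
noncomputable def sffForm (φ : M → N) (Z : Π y : N, TangentSpace 𝓘(ℝ, E') y) (p : M)
    (W : Π x : M, TangentSpace 𝓘(ℝ, E) x) : TangentSpace 𝓘(ℝ, E) p →L[ℝ] ℝ :=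
  mvfderiv 𝓘(ℝ, E) (fun x ↦ inner ℝ (Z (φ x)) (mfderiv 𝓘(ℝ, E) 𝓘(ℝ, E') φ x (W x))) p
  - (innerSL ℝ (Z (φ p))).comp ((mfderiv 𝓘(ℝ, E) 𝓘(ℝ, E') φ p).comp (leviCivita E M W p))
  - (innerSL ℝ (mfderiv 𝓘(ℝ, E) 𝓘(ℝ, E') φ p (W p))).comp
      ((leviCivita E' N Z (φ p)).comp (mfderiv 𝓘(ℝ, E) 𝓘(ℝ, E') φ p))

theorem sffForm_apply (φ : M → N) (Z : Π y : N, TangentSpace 𝓘(ℝ, E') y) (p : M)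
    (W : Π x : M, TangentSpace 𝓘(ℝ, E) x) (v : TangentSpace 𝓘(ℝ, E) p) :
    sffForm φ Z p W v =
      mvfderiv 𝓘(ℝ, E) (fun x ↦ inner ℝ (Z (φ x)) (mfderiv 𝓘(ℝ, E) 𝓘(ℝ, E') φ x (W x))) p v
      - inner ℝ (Z (φ p)) (mfderiv 𝓘(ℝ, E) 𝓘(ℝ, E') φ p (leviCivita E M W p v))
      - inner ℝ (leviCivita E' N Z (φ p) (mfderiv 𝓘(ℝ, E) 𝓘(ℝ, E') φ p v))
        (mfderiv 𝓘(ℝ, E) 𝓘(ℝ, E') φ p (W p)) := by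
  rw [real_inner_comm (mfderiv 𝓘(ℝ, E) 𝓘(ℝ, E') φ p (W p))]
  rfl

variable {φ : M → N} {Z : Π y : N, TangentSpace 𝓘(ℝ, E') y} {p : M}

theorem tensorialAt_sffForm (hφ : ContMDiffAt 𝓘(ℝ, E) 𝓘(ℝ, E') 2 φ p)
    (hZ : MDiffAt (T% Z) (φ p)) : TensorialAt 𝓘(ℝ, E) E (sffForm (E := E) φ Z p) p where
  smul {f W} hf hW := by
    ext v
    have h1 := (leviCivita E M).isCovariantDerivativeOnUniv.leibniz hW hf (Set.mem_univ p)
    have h2 := mvfderiv_fun_mul hf (mdifferentiableAt_inner_mfderiv hφ hZ hW)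
    have h3 : (fun x ↦ inner ℝ (Z (φ x)) (mfderiv 𝓘(ℝ, E) 𝓘(ℝ, E') φ x ((f • W) x))) =
        fun x ↦ f x * inner ℝ (Z (φ x)) (mfderiv 𝓘(ℝ, E) 𝓘(ℝ, E') φ x (W x)) := by
      funext x
      simp [inner_smul_right]
    rw [sffForm_apply, h3, h2, h1, smul_apply, sffForm_apply]
    simp [inner_smul_right, inner_add_right]
    ring
  add {W W'} hW hW' := by
    ext v
    have h1 := (leviCivita E M).isCovariantDerivativeOnUniv.add hW hW' (Set.mem_univ p)
    have h2 := mvfderiv_fun_add (mdifferentiableAt_inner_mfderiv hφ hZ hW)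
      (mdifferentiableAt_inner_mfderiv hφ hZ hW')
    have h3 : (fun x ↦ inner ℝ (Z (φ x)) (mfderiv 𝓘(ℝ, E) 𝓘(ℝ, E') φ x ((W + W') x))) =
        fun x ↦ inner ℝ (Z (φ x)) (mfderiv 𝓘(ℝ, E) 𝓘(ℝ, E') φ x (W x)) +
          inner ℝ (Z (φ x)) (mfderiv 𝓘(ℝ, E) 𝓘(ℝ, E') φ x (W' x)) := by
      funext x
      simp [inner_add_right]
    rw [sffForm_apply, h3, h2, h1]
    simp only [add_apply, sffForm_apply, Pi.add_apply, map_add, inner_add_right]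
    ring

theorem inner_secondFundamentalForm (hφ : ContMDiffAt 𝓘(ℝ, E) 𝓘(ℝ, E') 2 φ p)
    (hZ : MDiffAt (T% Z) (φ p)) (v w : TangentSpace 𝓘(ℝ, E) p) :
    inner ℝ (Z (φ p)) (secondFundamentalForm φ p v w) = sffForm φ Z p (extend E w) v := by
  have hw := mdifferentiableAt_extend 𝓘(ℝ, E) E w
  have h := mvfderiv_inner_along (MDifferentiableAt.mfderiv_section hφ hw) hZ v
  rw [sffForm_apply, h, secondFundamentalForm, inner_sub_right]
  ring

/-- The tension field may be computed from any orthonormal basis of `T_p M` and any vector fields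
extending it. -/
theorem inner_tensionField (hφ : ContMDiffAt 𝓘(ℝ, E) 𝓘(ℝ, E') 2 φ p)
    (hZ : MDiffAt (T% Z) (φ p)) {ι : Type*} [Fintype ι]
    (e : OrthonormalBasis ι ℝ (TangentSpace 𝓘(ℝ, E) p))
    {W : ι → Π x : M, TangentSpace 𝓘(ℝ, E) x}
    (hW : ∀ i, MDiffAt (fun x ↦ (⟨x, W i x⟩ : TangentBundle 𝓘(ℝ, E) M)) p)
    (hWe : ∀ i, W i p = e i) :
    inner ℝ (Z (φ p)) (tensionField (E := E) φ p) = ∑ i, sffForm φ Z p (W i) (W i p) := by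
  let L := TensorialAt.mkHom (sffForm (E := E) φ Z p) p (tensorialAt_sffForm hφ hZ)
  let β : TangentSpace 𝓘(ℝ, E) p →ₗ[ℝ] TangentSpace 𝓘(ℝ, E) p →ₗ[ℝ] ℝ :=
    LinearMap.mk₂ ℝ (fun w v ↦ L w v) (by simp) (by simp) (by simp) (by simp)
  have h := OrthonormalBasis.sum_bilin_eq β
    (stdOrthonormalBasis ℝ (TangentSpace 𝓘(ℝ, E) p)) e
  rw [tensionField, inner_sum]
  simp only [inner_secondFundamentalForm hφ hZ]
  refine h.trans (Finset.sum_congr rfl fun i _ ↦ ?_)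
  have h1 := TensorialAt.mkHom_apply (tensorialAt_sffForm hφ hZ) (hW i)
  rw [← h1, hWe i]
  rfl

end SecondFundamentalForm

/-! ### The second fundamental form in the normal and orbit directions -/

section NormalDirection

variable {E : Type*} [NormedAddCommGroup E] [NormedSpace ℝ E]
  {M : Type*} [TopologicalSpace M] [ChartedSpace E M]

variable {E' : Type*} [NormedAddCommGroup E'] [NormedSpace ℝ E']
  {N : Type*} [TopologicalSpace N] [ChartedSpace E' N]

/-- If `ψ ∘ γ = γ' ∘ r` near `s`, then `dψ` maps the velocity of `γ` at `s` to `r'(s)` times the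
velocity of `γ'` at `r s`. Both sides are vectors of the model space because the base points are
only propositionally equal. -/
theorem mfderiv_velocity_of_eventuallyEq {γ : ℝ → M} {γ' : ℝ → N} {ψ : M → N} {r : ℝ → ℝ} {s : ℝ}
    (hγ : MDifferentiableAt 𝓘(ℝ, ℝ) 𝓘(ℝ, E) γ s) (hγ' : MDifferentiableAt 𝓘(ℝ, ℝ) 𝓘(ℝ, E') γ' (r s))
    (hr : DifferentiableAt ℝ r s) (hψ : MDifferentiableAt 𝓘(ℝ, E) 𝓘(ℝ, E') ψ (γ s))
    (h : ψ ∘ γ =ᶠ[𝓝 s] γ' ∘ r) :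
    (mfderiv 𝓘(ℝ, E) 𝓘(ℝ, E') ψ (γ s) (velocity γ s) : E') =
      deriv r s • (velocity (E := E') γ' (r s) : E') := by
  have h1 := mfderiv_comp_apply s hψ hγ (1 : ℝ)
  have h2 := mfderiv_comp_apply s hγ' hr.mdifferentiableAt (1 : ℝ)
  rw [h.mfderiv_eq] at h1
  refine h1.symm.trans (h2.trans ?_)
  have h3 : (mfderiv 𝓘(ℝ, ℝ) 𝓘(ℝ, ℝ) r s (1 : ℝ) : ℝ) = deriv r s • (1 : ℝ) := by
    rw [mfderiv_eq_fderiv, smul_eq_mul, mul_one]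
    rfl
  refine (congrArg (mfderiv 𝓘(ℝ, ℝ) 𝓘(ℝ, E') γ' (r s)) h3).trans ?_
  exact map_smul (mfderiv 𝓘(ℝ, ℝ) 𝓘(ℝ, E') γ' (r s)) (deriv r s) (1 : ℝ)

theorem inner_mfderiv_velocity_of_eventuallyEq
    [RiemannianBundle (fun x : N ↦ TangentSpace 𝓘(ℝ, E') x)]
    {γ : ℝ → M} {γ' : ℝ → N} {ψ : M → N} {r : ℝ → ℝ} {s : ℝ} {Z : Π y : N, TangentSpace 𝓘(ℝ, E') y}
    (hγ : MDifferentiableAt 𝓘(ℝ, ℝ) 𝓘(ℝ, E) γ s) (hγ' : MDifferentiableAt 𝓘(ℝ, ℝ) 𝓘(ℝ, E') γ' (r s))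
    (hr : DifferentiableAt ℝ r s) (hψ : MDifferentiableAt 𝓘(ℝ, E) 𝓘(ℝ, E') ψ (γ s))
    (h : ψ ∘ γ =ᶠ[𝓝 s] γ' ∘ r) (hperp : inner ℝ (Z (γ' (r s))) (velocity γ' (r s)) = 0) :
    inner ℝ (Z (ψ (γ s))) (mfderiv 𝓘(ℝ, E) 𝓘(ℝ, E') ψ (γ s) (velocity γ s)) = 0 := by
  -- `ψ (γ s)` and `γ' (r s)` are only propositionally equal
  have (y : N) (hy : y = γ' (r s)) (u : TangentSpace 𝓘(ℝ, E') y)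
      (hu : (u : E') = deriv r s • (velocity (E := E') γ' (r s) : E')) :
      inner ℝ (Z y) u = 0 := by
    subst hy
    have hu' : u = deriv r s • velocity γ' (r s) := hu
    rw [hu', inner_smul_right, hperp, mul_zero]
  exact this _ h.self_of_nhds _ (mfderiv_velocity_of_eventuallyEq hγ hγ' hr hψ h)

variable [IsManifold 𝓘(ℝ, E) ∞ M]

theorem mdifferentiableAt_velocity {γ : ℝ → M} (hγ : ContMDiff 𝓘(ℝ, ℝ) 𝓘(ℝ, E) ∞ γ) (t : ℝ) :
    MDiffAt (fun s ↦ (⟨γ s, velocity γ s⟩ : TangentBundle 𝓘(ℝ, E) M)) t := by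
  have h1 : MDiffAt (T% fun s : ℝ ↦ (1 : TangentSpace 𝓘(ℝ, ℝ) s)) t :=
    (contMDiffAt_vectorSpace_iff_contDiffAt (n := 1)
      (V := fun s : ℝ ↦ (1 : TangentSpace 𝓘(ℝ, ℝ) s)).2 contDiffAt_const).mdifferentiableAt
      one_ne_zero
  exact MDifferentiableAt.mfderiv_section (hγ.contMDiffAt.of_le ENat.LEInfty.out) h1

variable [IsManifold 𝓘(ℝ, E') ∞ N] [FiniteDimensional ℝ E] [FiniteDimensional ℝ E']
  [RiemannianBundle (fun x : M ↦ TangentSpace 𝓘(ℝ, E) x)]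
  [IsContMDiffRiemannianBundle 𝓘(ℝ, E) ∞ E (fun x : M ↦ TangentSpace 𝓘(ℝ, E) x)]
  [RiemannianBundle (fun x : N ↦ TangentSpace 𝓘(ℝ, E') x)]
  [IsContMDiffRiemannianBundle 𝓘(ℝ, E') ∞ E' (fun x : N ↦ TangentSpace 𝓘(ℝ, E') x)]

/-- If `ψ` maps the geodesic `γ` to a reparametrization of the geodesic `γ'` and `Z` is orthogonal
to `γ'`, then `⟨Z, ∇dψ(v, v)⟩ = 0` for the velocity `v` of `γ`: the acceleration of `ψ ∘ γ` is
tangent to `γ'`. -/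
theorem sffForm_velocity {γ : ℝ → M} {γ' : ℝ → N} {ψ : M → N} {r : ℝ → ℝ} {t : ℝ}
    {Z : Π y : N, TangentSpace 𝓘(ℝ, E') y}
    (hγ : IsGeodesic (E := E) γ) (hγ' : IsGeodesic (E := E') γ')
    (hr : ∀ᶠ s in 𝓝 t, DifferentiableAt ℝ r s) (hψ : ContMDiffAt 𝓘(ℝ, E) 𝓘(ℝ, E') 2 ψ (γ t))
    (h : ψ ∘ γ =ᶠ[𝓝 t] γ' ∘ r) (hZ : ∀ y, MDiffAt (T% Z) y)
    (hperp : ∀ s, inner ℝ (Z (γ' s)) (velocity γ' s) = 0) :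
    sffForm (E := E) ψ Z (γ t) (extend E (velocity γ t)) (velocity γ t) = 0 := by
  have hγd (s) : MDifferentiableAt 𝓘(ℝ, ℝ) 𝓘(ℝ, E) γ s := hγ.contMDiff.mdifferentiable (by simp) s
  have hγd' (s) : MDifferentiableAt 𝓘(ℝ, ℝ) 𝓘(ℝ, E') γ' s :=
    hγ'.contMDiff.mdifferentiable (by simp) s
  have hψd : ∀ᶠ s in 𝓝 t, MDifferentiableAt 𝓘(ℝ, E) 𝓘(ℝ, E') ψ (γ s) :=
    (hγd t).continuousAt.eventually hψ.eventually_mdifferentiableAt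
  have hzero : (fun s ↦ inner ℝ (Z (ψ (γ s))) (mfderiv 𝓘(ℝ, E) 𝓘(ℝ, E') ψ (γ s) (velocity γ s)))
      =ᶠ[𝓝 t] fun _ ↦ 0 := by
    filter_upwards [hr, hψd, h.eventually_nhds] with s h1 h2 h3
    exact inner_mfderiv_velocity_of_eventuallyEq (hγd s) (hγd' _) h1 h2 h3 (hperp _)
  let α : Π x : M, TangentSpace 𝓘(ℝ, E) x →ₗ[ℝ] ℝ := fun x ↦
    innerₛₗ ℝ (Z (ψ x)) ∘ₗ (mfderiv 𝓘(ℝ, E) 𝓘(ℝ, E') ψ x).toLinearMap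
  -- the pull-back of the one-form `⟨Z, dψ ·⟩` to `γ` vanishes on the velocity, which is parallel
  have h1 := mvfderiv_oneForm_along_eq_pullbackConnection (leviCivita E M)
    (mdifferentiableAt_velocity hγ.contMDiff t) (α := α)
    (fun u ↦ mdifferentiableAt_inner_mfderiv hψ (hZ _) (mdifferentiableAt_extend 𝓘(ℝ, E) E u))
    (1 : ℝ)
  have h2 : mvfderiv 𝓘(ℝ, ℝ) (fun s ↦ α (γ s) (velocity γ s)) t (1 : ℝ) = 0 := by
    refine (congrArg (fun L : ℝ →L[ℝ] ℝ ↦ L 1)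
      (hzero.mfderiv_eq (I := 𝓘(ℝ, ℝ)) (I' := 𝓘(ℝ, ℝ)))).trans ?_
    rw [mfderiv_const]
    rfl
  rw [h2, hγ.acceleration_eq_zero, map_zero, add_zero] at h1
  have h3 (τ : ℝ) : inner ℝ (leviCivita E' N Z (γ' τ) (velocity γ' τ)) (velocity γ' τ) = 0 := by
    have h4 := mvfderiv_inner_along (mdifferentiableAt_velocity hγ'.contMDiff τ) (hZ (γ' τ)) (1 : ℝ)
    rw [hγ'.acceleration_eq_zero, inner_zero_right, add_zero, funext hperp, mvfderiv_const] at h4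
    exact h4.symm
  have h4 : inner ℝ (leviCivita E' N Z (ψ (γ t))
      (mfderiv 𝓘(ℝ, E) 𝓘(ℝ, E') ψ (γ t) (velocity γ t)))
      (mfderiv 𝓘(ℝ, E) 𝓘(ℝ, E') ψ (γ t) (velocity γ t)) = 0 := by
    have (y : N) (τ c : ℝ) (hy : y = γ' τ) (u : TangentSpace 𝓘(ℝ, E') y)
        (hu : (u : E') = c • (velocity (E := E') γ' τ : E')) :
        inner ℝ (leviCivita E' N Z y u) u = 0 := by
      subst hy
      have hu' : u = c • velocity γ' τ := hu
      rw [hu', map_smul, inner_smul_right, inner_smul_left, h3, mul_zero, mul_zero]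
    exact this _ _ _ h.self_of_nhds _ (mfderiv_velocity_of_eventuallyEq (hγd t) (hγd' _)
      hr.self_of_nhds hψd.self_of_nhds h)
  rw [sffForm_apply, extend_apply_self, h4, sub_zero]
  exact h1.symm

end NormalDirection

section OrbitDirection

variable {F : Type*} [NormedAddCommGroup F] [NormedSpace ℝ F]
  {G : Type*} [TopologicalSpace G] [ChartedSpace F G] [Group G]
  {F' : Type*} [NormedAddCommGroup F'] [NormedSpace ℝ F']
  {K : Type*} [TopologicalSpace K] [ChartedSpace F' K] [Group K]
  {E : Type*} [NormedAddCommGroup E] [NormedSpace ℝ E]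
  {M : Type*} [TopologicalSpace M] [ChartedSpace E M]
  [MulAction G M] [ContMDiffSMul 𝓘(ℝ, F) 𝓘(ℝ, E) ∞ G M]
  {E' : Type*} [NormedAddCommGroup E'] [NormedSpace ℝ E']
  {N : Type*} [TopologicalSpace N] [ChartedSpace E' N]
  [MulAction K N] [ContMDiffSMul 𝓘(ℝ, F') 𝓘(ℝ, E') ∞ K N]

/-- An equivariant map sends `X*` to `(dA X)*`. -/
theorem mfderiv_actionField_of_equivariant {A : G →* K} {ψ : M → N} {p : M}
    (hA : MDifferentiableAt 𝓘(ℝ, F) 𝓘(ℝ, F') A 1)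
    (hψ : MDifferentiableAt 𝓘(ℝ, E) 𝓘(ℝ, E') ψ p) (h : ∀ g : G, ψ (g • p) = A g • ψ p)
    (X : GroupLieAlgebra 𝓘(ℝ, F) G) :
    mfderiv 𝓘(ℝ, E) 𝓘(ℝ, E') ψ p (actionField p X) =
      actionField (ψ p) (lieDifferential (F := F) (F' := F') A X) := by
  have h1 : ψ ∘ (fun g : G ↦ g • p) = (fun k : K ↦ k • ψ p) ∘ A := funext h
  have h2 := mfderiv_comp_apply_of_eq (1 : G) hψ (mdifferentiableAt_orbitMap (E := E) p 1)
    (one_smul G p) X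
  have h3 := mfderiv_comp_apply_of_eq (1 : G) (mdifferentiableAt_orbitMap (E := E') (ψ p) (1 : K))
    hA (map_one A) X
  rw [h1] at h2
  exact h2.symm.trans h3

variable [FiniteDimensional ℝ F'] [FiniteDimensional ℝ E]
  [FiniteDimensional ℝ E'] [LieGroup 𝓘(ℝ, F) ∞ G] [LieGroup 𝓘(ℝ, F') ∞ K]
  [IsManifold 𝓘(ℝ, E) ∞ M] [IsManifold 𝓘(ℝ, E') ∞ N]
  [RiemannianBundle (fun x : M ↦ TangentSpace 𝓘(ℝ, E) x)]
  [IsContMDiffRiemannianBundle 𝓘(ℝ, E) ∞ E (fun x : M ↦ TangentSpace 𝓘(ℝ, E) x)]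
  [RiemannianBundle (fun x : N ↦ TangentSpace 𝓘(ℝ, E') x)]
  [IsContMDiffRiemannianBundle 𝓘(ℝ, E') ∞ E' (fun x : N ↦ TangentSpace 𝓘(ℝ, E') x)]

/-- With `W = dA X`, the function `⟨Z*, dψ X*⟩` equals `⟨Z*, W*⟩ ∘ ψ` along the orbit of `p`, and
`⟨∇_{W*} Z*, W*⟩ = 0` because `Z*` is a Killing field. -/
theorem sffForm_actionField (hN : IsCohomogeneityOneAction F' K E' N) {A : G →* K} {ψ : M → N}
    {p : M} (hA : MDifferentiableAt 𝓘(ℝ, F) 𝓘(ℝ, F') A 1)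
    (hψ : ContMDiffAt 𝓘(ℝ, E) 𝓘(ℝ, E') 2 ψ p) (h : ∀ g : G, ψ (g • p) = A g • ψ p)
    (X : GroupLieAlgebra 𝓘(ℝ, F) G) (Z : GroupLieAlgebra 𝓘(ℝ, F') K) :
    sffForm ψ (fun y ↦ actionField (E := E') y Z) p (fun x ↦ actionField (E := E) x X)
        (actionField p X) =
      - inner ℝ (actionField (E := E') (ψ p) (lieDifferential (F := F) (F' := F') A X))
          (actionField (ψ p) ⁅lieDifferential (F := F) (F' := F') A X, Z⁆)
      - inner ℝ (actionField (E := E') (ψ p) Z) (mfderiv 𝓘(ℝ, E) 𝓘(ℝ, E') ψ p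
          (leviCivita E M (fun x ↦ actionField (E := E) x X) p (actionField p X))) := by
  have := FiniteDimensional.complete ℝ F'
  have : LieGroup 𝓘(ℝ, F') (minSmoothness ℝ 3) K := by
    rw [minSmoothness_of_isRCLikeNormedField]; infer_instance
  set W : GroupLieAlgebra 𝓘(ℝ, F') K := lieDifferential (F := F) (F' := F') A X
  have hX := mdifferentiableAt_actionField (E := E) X p
  have hZ (y : N) := mdifferentiableAt_actionField (E := E') Z y
  have hW (y : N) := mdifferentiableAt_actionField (E := E') W y
  have hψd := hψ.mdifferentiableAt two_ne_zero
  have hdψ (x : M) (hx : MDifferentiableAt 𝓘(ℝ, E) 𝓘(ℝ, E') ψ x)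
      (hx' : ∀ g : G, ψ (g • x) = A g • ψ x) :=
    mfderiv_actionField_of_equivariant hA hx hx' X
  have horb : Filter.Tendsto (fun g : G ↦ g • p) (𝓝 1) (𝓝 p) := by
    have := (mdifferentiableAt_orbitMap (F := F) (E := E) p (1 : G)).continuousAt
    simpa [ContinuousAt] using this
  let f : M → ℝ := fun x ↦ inner ℝ (actionField (E := E') (ψ x) Z)
    (mfderiv 𝓘(ℝ, E) 𝓘(ℝ, E') ψ x (actionField x X))
  let f' : N → ℝ := fun y ↦ inner ℝ (actionField (E := E') y Z) (actionField y W)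
  have hf : MDiffAt f p := mdifferentiableAt_inner_mfderiv hψ (hZ _) hX
  have hf' : MDiffAt f' (ψ p) := mdifferentiableAt_inner (hZ _) (hW _)
  have hff' : f ∘ (fun g : G ↦ g • p) =ᶠ[𝓝 1] (f' ∘ ψ) ∘ fun g : G ↦ g • p := by
    filter_upwards [horb.eventually hψ.eventually_mdifferentiableAt] with g hg
    simp only [Function.comp_apply, f, f']
    rw [hdψ (g • p) hg fun k ↦ by rw [← mul_smul, h, h, map_mul, mul_smul]]
  have h1 := mfderiv_comp_apply_of_eq (1 : G) hf (mdifferentiableAt_orbitMap (E := E) p 1)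
    (one_smul G p) X
  have h2 := mfderiv_comp_apply_of_eq (1 : G) (hf'.comp p hψd)
    (mdifferentiableAt_orbitMap (E := E) p 1) (one_smul G p) X
  have h3 := mfderiv_comp_apply p hf' hψd (actionField p X)
  rw [hdψ p hψd h] at h3
  rw [hff'.mfderiv_eq] at h1
  have h4 : mvfderiv 𝓘(ℝ, E) f p (actionField p X) =
      - inner ℝ (actionField (E := E') (ψ p) W) (actionField (ψ p) ⁅W, Z⁆) := by
    refine (h1.symm.trans (h2.trans h3)).trans ((mvfderiv_inner_actionField hN _ W Z W).trans ?_)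
    rw [lie_self, map_zero, inner_zero_right, sub_zero, real_inner_comm]
  rw [sffForm_apply, hdψ p hψd h, inner_leviCivita_actionField_self hN, sub_zero]
  exact congrArg (· - _) h4

end OrbitDirection

/-! ### The tension field -/

section TensionField

variable {F : Type*} [NormedAddCommGroup F] [NormedSpace ℝ F]
  {G : Type*} [TopologicalSpace G] [ChartedSpace F G] [Group G]
  {E : Type*} [NormedAddCommGroup E] [NormedSpace ℝ E] [FiniteDimensional ℝ E]
  {M : Type*} [TopologicalSpace M] [ChartedSpace E M] [IsManifold 𝓘(ℝ, E) ∞ M]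
  [RiemannianBundle (fun x : M ↦ TangentSpace 𝓘(ℝ, E) x)]
  [IsContMDiffRiemannianBundle 𝓘(ℝ, E) ∞ E (fun x : M ↦ TangentSpace 𝓘(ℝ, E) x)]
  [MulAction G M]

/-- At a point of an orbit of codimension one, the velocity of the normal geodesic completes an
orthonormal basis of the tangent space of the orbit. -/
theorem exists_orthonormalBasis_velocity_actionField {γ : ℝ → M}
    (hγ : IsUnitSpeedNormalGeodesic F G E γ) {t : ℝ} (hreg : IsNonsingularPoint F G E (γ t))
    {ι : Type*} [Fintype ι] {X : ι → GroupLieAlgebra 𝓘(ℝ, F) G}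
    (hXorth : Orthonormal ℝ (fun i ↦ (actionField (γ t) (X i) : TangentSpace 𝓘(ℝ, E) (γ t))))
    (hXspan : Submodule.span ℝ
      (Set.range fun i ↦ (actionField (γ t) (X i) : TangentSpace 𝓘(ℝ, E) (γ t))) =
        orbitTangent F G (γ t)) :
    ∃ e : OrthonormalBasis (Option ι) ℝ (TangentSpace 𝓘(ℝ, E) (γ t)),
      e none = velocity γ t ∧ ∀ i, e (some i) = actionField (γ t) (X i) := by
  classical
  let f : Option ι → TangentSpace 𝓘(ℝ, E) (γ t) :=
    fun i ↦ i.elim (velocity γ t) fun i ↦ actionField (γ t) (X i)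
  have hf : Orthonormal ℝ f := by
    refine ⟨?_, ?_⟩
    · rintro (_ | i)
      · exact hγ.norm_velocity t
      · exact hXorth.1 i
    · rintro (_ | i) (_ | j) hij
      · exact absurd rfl hij
      · change inner ℝ (velocity γ t) (actionField (γ t) (X j)) = 0
        rw [real_inner_comm]
        exact hγ.perpendicular t _
      · exact hγ.perpendicular t _
      · exact hXorth.2 fun h ↦ hij (congrArg some h)
  have hcard : Fintype.card (Option ι) = finrank ℝ (TangentSpace 𝓘(ℝ, E) (γ t)) := by
    rw [Fintype.card_option, ← finrank_span_eq_card hXorth.linearIndependent, hXspan]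
    exact hreg
  refine ⟨OrthonormalBasis.mk hf
    (hf.linearIndependent.span_eq_top_of_card_eq_finrank' hcard).ge, ?_, fun i ↦ ?_⟩
  · rw [OrthonormalBasis.coe_mk]
    rfl
  · rw [OrthonormalBasis.coe_mk]
    rfl

variable {F' : Type*} [NormedAddCommGroup F'] [NormedSpace ℝ F']
  {K : Type*} [TopologicalSpace K] [ChartedSpace F' K] [Group K]
  {E' : Type*} [NormedAddCommGroup E'] [NormedSpace ℝ E'] [FiniteDimensional ℝ E']
  {N : Type*} [TopologicalSpace N] [ChartedSpace E' N] [IsManifold 𝓘(ℝ, E') ∞ N]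
  [RiemannianBundle (fun x : N ↦ TangentSpace 𝓘(ℝ, E') x)]
  [IsContMDiffRiemannianBundle 𝓘(ℝ, E') ∞ E' (fun x : N ↦ TangentSpace 𝓘(ℝ, E') x)]
  [MulAction K N]

/-- The projection to the orbit is determined by the inner products with action fields. -/
theorem tangentialTensionField_eq_actionField {ψ : M → N} {p : M}
    {V : GroupLieAlgebra 𝓘(ℝ, F') K}
    (h : ∀ Z : GroupLieAlgebra 𝓘(ℝ, F') K,
      inner ℝ (actionField (E := E') (ψ p) Z) (tensionField (E := E) ψ p) =
        inner ℝ (actionField (E := E') (ψ p) V) (actionField (ψ p) Z)) :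
    tangentialTensionField E E' F' K ψ p = actionField (ψ p) V := by
  refine Submodule.eq_starProjection_of_mem_of_inner_eq_zero ⟨V, rfl⟩ ?_
  rintro _ ⟨Z, rfl⟩
  rw [inner_sub_left, sub_eq_zero, real_inner_comm]
  exact h Z

variable [FiniteDimensional ℝ F] [LieGroup 𝓘(ℝ, F) ∞ G] [ContMDiffSMul 𝓘(ℝ, F) 𝓘(ℝ, E) ∞ G M]
  [FiniteDimensional ℝ F'] [LieGroup 𝓘(ℝ, F') ∞ K] [ContMDiffSMul 𝓘(ℝ, F') 𝓘(ℝ, E') ∞ K N]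

/-- The pairing of the tension field with `Z*`. The sum `∑ ∇_{X*} X*` is orthogonal to the orbit,
so that `dψ` maps it to a multiple of the velocity of `γ'`, and this is orthogonal to `Z*`. -/
theorem inner_actionField_tensionField
    (hM : IsCohomogeneityOneAction F G E M) (hN : IsCohomogeneityOneAction F' K E' N)
    {Q : ContMDiffRiemannianMetric 𝓘(ℝ, F) ∞ F (fun g : G ↦ TangentSpace 𝓘(ℝ, F) g)}
    (hQ : IsBiinvariant Q)
    {γ : ℝ → M} (hγ : IsUnitSpeedNormalGeodesic F G E γ)
    {γ' : ℝ → N} (hγ' : IsUnitSpeedNormalGeodesic F' K E' γ')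
    {A : G →* K} (hA : ContMDiff 𝓘(ℝ, F) 𝓘(ℝ, F') ∞ A)
    {J : Set ℝ} (hJ : IsOpen J) {r : ℝ → ℝ} (hr : ContDiffOn ℝ ∞ r J)
    {ψ : M → N} (hψ : ∀ g : G, ∀ s ∈ J, ψ (g • γ s) = A g • γ' (r s))
    {t : ℝ} (ht : t ∈ J) (hreg : IsNonsingularPoint F G E (γ t))
    {ι : Type*} [Fintype ι] {X : ι → GroupLieAlgebra 𝓘(ℝ, F) G}
    (hX : ∀ i, X i ∈ lieComplement Q (MulAction.stabilizer G (γ t)))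
    (hXorth : Orthonormal ℝ (fun i ↦ (actionField (γ t) (X i) : TangentSpace 𝓘(ℝ, E) (γ t))))
    (hXspan : Submodule.span ℝ
      (Set.range fun i ↦ (actionField (γ t) (X i) : TangentSpace 𝓘(ℝ, E) (γ t))) =
        orbitTangent F G (γ t))
    (Z : GroupLieAlgebra 𝓘(ℝ, F') K) :
    inner ℝ (actionField (E := E') (ψ (γ t)) Z) (tensionField (E := E) ψ (γ t)) =
      - ∑ i, inner ℝ (actionField (E := E') (ψ (γ t)) (lieDifferential (F := F) (F' := F') A (X i)))
          (actionField (ψ (γ t)) ⁅lieDifferential (F := F) (F' := F') A (X i), Z⁆) := by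
  obtain ⟨e, he0, he⟩ := exists_orthonormalBasis_velocity_actionField hγ hreg hXorth hXspan
  have hJt : J ∈ 𝓝 t := hJ.mem_nhds ht
  have hψ1 : ∀ s ∈ J, ψ (γ s) = γ' (r s) := fun s hs ↦ by simpa using hψ 1 s hs
  have hψγ : ψ ∘ γ =ᶠ[𝓝 t] γ' ∘ r := Filter.eventually_of_mem hJt hψ1
  have hequiv (g : G) : ψ (g • γ t) = A g • ψ (γ t) := by rw [hψ g t ht, hψ1 t ht]
  have hrd : ∀ᶠ s in 𝓝 t, DifferentiableAt ℝ r s :=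
    Filter.eventually_of_mem hJt fun s hs ↦
      (hr.contDiffAt (hJ.mem_nhds hs)).differentiableAt (by simp)
  have hψd : ContMDiffAt 𝓘(ℝ, E) 𝓘(ℝ, E') 2 ψ (γ t) := by
    refine (contMDiffAt_of_equivariant hγ.contMDiff hγ'.contMDiff hA hJt hr hψ fun v ↦ ?_).of_le
      ENat.LEInfty.out
    refine ⟨∑ i, inner ℝ (e (some i)) v • X i, inner ℝ (e none) v, ?_⟩
    conv_lhs => rw [← e.sum_repr' v]
    rw [Fintype.sum_option, add_comm, map_sum, he0]
    simp only [map_smul, he]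
  have hAd : MDifferentiableAt 𝓘(ℝ, F) 𝓘(ℝ, F') A 1 := hA.mdifferentiable (by simp) 1
  have hvel : inner ℝ (actionField (E := E') (ψ (γ t)) Z)
      (mfderiv 𝓘(ℝ, E) 𝓘(ℝ, E') ψ (γ t) (velocity γ t)) = 0 :=
    inner_mfderiv_velocity_of_eventuallyEq (Z := fun y ↦ actionField (E := E') y Z)
      (hγ.contMDiff.mdifferentiable (by simp) t) (hγ'.contMDiff.mdifferentiable (by simp) _)
      hrd.self_of_nhds (hψd.mdifferentiableAt two_ne_zero) hψγ (hγ'.perpendicular _ Z)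
  let W : Option ι → Π x : M, TangentSpace 𝓘(ℝ, E) x :=
    fun i ↦ i.elim (extend E (velocity γ t)) fun i x ↦ actionField x (X i)
  have hZd (y : N) := mdifferentiableAt_actionField (E := E') Z y
  have h1 := inner_tensionField (W := W) hψd (hZd _) e
    (by
      rintro (_ | i)
      · exact mdifferentiableAt_extend 𝓘(ℝ, E) E _
      · exact mdifferentiableAt_actionField (X i) _)
    (by
      rintro (_ | i)
      · exact (extend_apply_self ..).trans he0.symm
      · exact (he i).symm)
  set H : TangentSpace 𝓘(ℝ, E) (γ t) :=
    ∑ i, leviCivita E M (fun x ↦ actionField (E := E) x (X i)) (γ t) (actionField (γ t) (X i))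
  have hH (Y : GroupLieAlgebra 𝓘(ℝ, F) G) : inner ℝ (actionField (E := E) (γ t) Y) H = 0 := by
    rw [real_inner_comm, sum_inner, ← sum_inner_actionField_lie hQ (γ t) hX hXorth hXspan Y]
    exact Finset.sum_congr rfl fun i _ ↦ inner_leviCivita_actionField hM _ _ _
  have hH' : inner ℝ (actionField (E := E') (ψ (γ t)) Z)
      (mfderiv 𝓘(ℝ, E) 𝓘(ℝ, E') ψ (γ t) H) = 0 := by
    rw [← e.sum_repr' H, Fintype.sum_option]
    simp only [he, hH, zero_smul, Finset.sum_const_zero, add_zero, he0, map_smul,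
      inner_smul_right, hvel, mul_zero]
  refine h1.trans ?_
  rw [Fintype.sum_option]
  have h2 : sffForm ψ (fun y ↦ actionField (E := E') y Z) (γ t) (W none) (W none (γ t)) = 0 := by
    have h3 := sffForm_velocity hγ.toIsGeodesic hγ'.toIsGeodesic hrd hψd hψγ hZd
      (fun s ↦ hγ'.perpendicular s Z)
    refine Eq.trans ?_ h3
    exact congrArg (sffForm ψ (fun y ↦ actionField (E := E') y Z) (γ t) (W none))
      (extend_apply_self ..)
  have h3 (i : ι) := sffForm_actionField (E := E) hN hAd hψd hequiv (X i) Z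
  rw [h2, zero_add]
  refine (Finset.sum_congr rfl fun i _ ↦ h3 i).trans ?_
  rw [Finset.sum_sub_distrib, Finset.sum_neg_distrib, ← inner_sum, ← map_sum, hH', sub_zero]

/-- The base point `q = ψ (γ t)` of the orbit in `N` is a variable here, because the equation
`ψ (γ t) = γ' (r t)` cannot be substituted. -/
theorem exists_tangentialTensionField_eq
    (hM : IsCohomogeneityOneAction F G E M) (hN : IsCohomogeneityOneAction F' K E' N)
    {Q : ContMDiffRiemannianMetric 𝓘(ℝ, F) ∞ F (fun g : G ↦ TangentSpace 𝓘(ℝ, F) g)}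
    (hQ : IsBiinvariant Q)
    {Q' : ContMDiffRiemannianMetric 𝓘(ℝ, F') ∞ F' (fun k : K ↦ TangentSpace 𝓘(ℝ, F') k)}
    (hQ' : IsBiinvariant Q')
    {γ : ℝ → M} (hγ : IsUnitSpeedNormalGeodesic F G E γ)
    {γ' : ℝ → N} (hγ' : IsUnitSpeedNormalGeodesic F' K E' γ')
    {A : G →* K} (hA : ContMDiff 𝓘(ℝ, F) 𝓘(ℝ, F') ∞ A)
    {J : Set ℝ} (hJ : IsOpen J) {r : ℝ → ℝ} (hr : ContDiffOn ℝ ∞ r J)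
    {ψ : M → N} (hψ : ∀ g : G, ∀ s ∈ J, ψ (g • γ s) = A g • γ' (r s))
    {t : ℝ} (ht : t ∈ J) (hreg : IsNonsingularPoint F G E (γ t))
    {ι : Type*} [Fintype ι] {X : ι → GroupLieAlgebra 𝓘(ℝ, F) G}
    (hX : ∀ i, X i ∈ lieComplement Q (MulAction.stabilizer G (γ t)))
    (hXorth : Orthonormal ℝ (fun i ↦ (actionField (γ t) (X i) : TangentSpace 𝓘(ℝ, E) (γ t))))
    (hXspan : Submodule.span ℝ
      (Set.range fun i ↦ (actionField (γ t) (X i) : TangentSpace 𝓘(ℝ, E) (γ t))) =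
        orbitTangent F G (γ t))
    {q : N} (hq : ψ (γ t) = q) :
    let n' := lieComplement Q' (MulAction.stabilizer K q)
    let P' : n' →ₗ[ℝ] n' := metricEndomorphism E' Q' n' q
    let dA : GroupLieAlgebra 𝓘(ℝ, F) G →L[ℝ] GroupLieAlgebra 𝓘(ℝ, F') K := lieDifferential A
    let S : GroupLieAlgebra 𝓘(ℝ, F') K :=
      ∑ i, ⁅dA (X i), (P' (lieProjection Q' n' (dA (X i))) : GroupLieAlgebra 𝓘(ℝ, F') K)⁆
    ∃ (hS : S ∈ n') (hP : Function.Bijective P'),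
      (⟨ψ (γ t), tangentialTensionField E E' F' K ψ (γ t)⟩ : TangentBundle 𝓘(ℝ, E') N) =
        ⟨q, actionField q
          ((LinearEquiv.ofBijective P' hP).symm ⟨S, hS⟩ : GroupLieAlgebra 𝓘(ℝ, F') K)⟩ := by
  subst hq
  intro n' P' dA S
  have hS : S ∈ n' := sum_mem fun i _ ↦ lie_metricEndomorphism_mem_lieComplement hN hQ' _ _
  have hP : Function.Bijective P' := bijective_metricEndomorphism (E := E') (Q := Q') _
  refine ⟨hS, hP, congrArg (TotalSpace.mk (ψ (γ t))) ?_⟩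
  refine tangentialTensionField_eq_actionField fun Z ↦ ?_
  rw [inner_actionField_tensionField hM hN hQ hγ hγ' hA hJ hr hψ ht hreg hX hXorth hXspan Z,
    ← inner_metricEndomorphism_left (Q := Q')]
  have h1 : P' ((LinearEquiv.ofBijective P' hP).symm ⟨S, hS⟩) = ⟨S, hS⟩ :=
    (LinearEquiv.ofBijective P' hP).apply_symm_apply _
  refine Eq.trans ?_ (congrArg (fun V : n' ↦ Q'.inner 1 (V : GroupLieAlgebra 𝓘(ℝ, F') K) Z) h1.symm)
  change _ = Q'.inner 1 S Z
  rw [map_sum, sum_apply, ← Finset.sum_neg_distrib]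
  exact Finset.sum_congr rfl fun i _ ↦ (inner_lie_metricEndomorphism hQ' _ _ _).symm

end TensionField

theorem mainTheorem5
    -- the compact Lie groups `G` and `K`
    {F : Type*} [NormedAddCommGroup F] [NormedSpace ℝ F] [FiniteDimensional ℝ F]
    {G : Type*} [TopologicalSpace G] [T2Space G] [CompactSpace G] [ChartedSpace F G] [Group G]
    [LieGroup 𝓘(ℝ, F) ∞ G]
    {F' : Type*} [NormedAddCommGroup F'] [NormedSpace ℝ F'] [FiniteDimensional ℝ F']
    {K : Type*} [TopologicalSpace K] [T2Space K] [CompactSpace K] [ChartedSpace F' K] [Group K]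
    [LieGroup 𝓘(ℝ, F') ∞ K]
    -- the connected Riemannian manifold `M` with a smooth action of `G`
    {E : Type*} [NormedAddCommGroup E] [NormedSpace ℝ E] [FiniteDimensional ℝ E]
    {M : Type*} [TopologicalSpace M] [T2Space M] [SecondCountableTopology M] [ConnectedSpace M]
    [ChartedSpace E M] [IsManifold 𝓘(ℝ, E) ∞ M]
    [RiemannianBundle (fun x : M ↦ TangentSpace 𝓘(ℝ, E) x)]
    [IsContMDiffRiemannianBundle 𝓘(ℝ, E) ∞ E (fun x : M ↦ TangentSpace 𝓘(ℝ, E) x)]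
    [MulAction G M] [ContMDiffSMul 𝓘(ℝ, F) 𝓘(ℝ, E) ∞ G M]
    -- the connected Riemannian manifold `N` with a smooth action of `K`
    {E' : Type*} [NormedAddCommGroup E'] [NormedSpace ℝ E'] [FiniteDimensional ℝ E']
    {N : Type*} [TopologicalSpace N] [T2Space N] [SecondCountableTopology N] [ConnectedSpace N]
    [ChartedSpace E' N] [IsManifold 𝓘(ℝ, E') ∞ N]
    [RiemannianBundle (fun x : N ↦ TangentSpace 𝓘(ℝ, E') x)]
    [IsContMDiffRiemannianBundle 𝓘(ℝ, E') ∞ E' (fun x : N ↦ TangentSpace 𝓘(ℝ, E') x)]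
    [MulAction K N] [ContMDiffSMul 𝓘(ℝ, F') 𝓘(ℝ, E') ∞ K N]
    -- both actions are of cohomogeneity one
    (hM : IsCohomogeneityOneAction F G E M) (hN : IsCohomogeneityOneAction F' K E' N)
    -- the biinvariant metrics on `G` and `K`
    (Q : ContMDiffRiemannianMetric 𝓘(ℝ, F) ∞ F (fun g : G ↦ TangentSpace 𝓘(ℝ, F) g))
    (hQ : IsBiinvariant Q)
    (Q' : ContMDiffRiemannianMetric 𝓘(ℝ, F') ∞ F' (fun k : K ↦ TangentSpace 𝓘(ℝ, F') k))
    (hQ' : IsBiinvariant Q')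
    -- the normal geodesics
    (γ : ℝ → M) (hγ : IsUnitSpeedNormalGeodesic F G E γ)
    (γ' : ℝ → N) (hγ' : IsUnitSpeedNormalGeodesic F' K E' γ')
    -- the homomorphism `A` and the equivariant map `ψ (g • γ s) = A g • γ' (r s)`
    (A : G →* K) (hA : ContMDiff 𝓘(ℝ, F) 𝓘(ℝ, F') ∞ A)
    (J : Set ℝ) (hJ : IsOpen J) (r : ℝ → ℝ) (hr : ContDiffOn ℝ ∞ r J)
    (ψ : M → N) (hψ : ∀ (g : G), ∀ s ∈ J, ψ (g • γ s) = A g • γ' (r s))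
    -- a parameter for which `γ t` and `γ' (r t)` lie on orbits of codimension one
    (t : ℝ) (ht : t ∈ J)
    (hreg : IsNonsingularPoint F G E (γ t)) (hreg' : IsNonsingularPoint F' K E' (γ' (r t)))
    -- elements of `𝔫` whose action fields form an orthonormal basis of the tangent space of the
    -- orbit of `γ t`
    (n : ℕ) (X : Fin n → GroupLieAlgebra 𝓘(ℝ, F) G)
    (hX : ∀ μ, X μ ∈ lieComplement Q (MulAction.stabilizer G (γ t)))
    (hXorth : Orthonormal ℝ
      (fun μ ↦ (actionField (γ t) (X μ) : TangentSpace 𝓘(ℝ, E) (γ t))))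
    (hXspan : Submodule.span ℝ
      (Set.range fun μ ↦ (actionField (γ t) (X μ) : TangentSpace 𝓘(ℝ, E) (γ t))) =
        orbitTangent F G (γ t)) :
    let n' := lieComplement Q' (MulAction.stabilizer K (γ' (r t)))
    let P' : n' →ₗ[ℝ] n' := metricEndomorphism E' Q' n' (γ' (r t))
    let dA : GroupLieAlgebra 𝓘(ℝ, F) G →L[ℝ] GroupLieAlgebra 𝓘(ℝ, F') K := lieDifferential A
    let S : GroupLieAlgebra 𝓘(ℝ, F') K :=
      ∑ μ, ⁅dA (X μ), (P' (lieProjection Q' n' (dA (X μ))) : GroupLieAlgebra 𝓘(ℝ, F') K)⁆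
    ∃ (hS : S ∈ n') (hP : Function.Bijective P'),
      (⟨ψ (γ t), tangentialTensionField E E' F' K ψ (γ t)⟩ : TangentBundle 𝓘(ℝ, E') N) =
        ⟨γ' (r t), actionField (γ' (r t))
          ((LinearEquiv.ofBijective P' hP).symm ⟨S, hS⟩ : GroupLieAlgebra 𝓘(ℝ, F') K)⟩ := by
  exact exists_tangentialTensionField_eq hM hN hQ hQ' hγ hγ' hA hJ hr hψ ht hreg hX hXorth hXspan
    (by simpa using hψ 1 t ht)
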